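/- Let $m\ge 0$ be an integer, $N=2m$, and let $B$ be a non-degenerate skew-symmetric $N\times N$ matrix over $\mathbb C$; write $(x|y)=\sum_i x_iy_i$ on $\mathbb C^N$. Let $A=\mathbb C[t_1^{\pm1},\dots,t_N^{\pm1}]$, and for $u\in\mathbb C^N$, $r\in\mathbb Z^N$ let $D(u,r)$ be the derivation $t^s\mapsto (u|s)\,t^{r+s}$ of $A$. Put $h_r=D(Br,r)$, $H_B=\mathrm{span}\{h_r: r\in\mathbb Z^N\}$, $\mathfrak d=\mathrm{span}\{D(u,0):u\in\mathbb C^N\}$ and $\widetilde H_B=H_B\oplus \mathfrak d$, a Lie algebra of derivations of $A$, and form $\widetilde H_B\ltimes A$ with $A$ an abelian ideal. A jet module is a module for $\widetilde H_B\ltimes A$ on which $t^rt^s=t^{r+s}$ for all $r,s\in\mathbb Z^N$ and $t^0=\mathrm{id}$; it is irreducible if it is irreducible over $\widetilde H_B\ltimes A$, and it has finite-dimensional weight spaces if it is the direct sum of its weight spaces $V_\mu=\{v: D(u,0)v=(u|\mu)v\ \ \forall u\in\mathbb C^N\}$, $\mu\in\mathbb C^N$, and all of these are finite-dimensional. Let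 $U'$ be the quotient of the universal enveloping algebra of $\widetilde H_B\ltimes A$ by the two-sided ideal generated by all $t^rt^s-t^{r+s}$ and $t^0-1$, and let $T\subset U'$ be the span of the elements $T(r)=t^{-r}h_r-D(Br,0)$, $r\in\mathbb Z^N$; it is a Lie algebra under the commutator, with $[T(r),T(s)]=(Br|s)\,(T(r+s)-T(r)-T(s))$. Let $\mathfrak G_B=\{X\in\mathfrak{gl}_N(\mathbb C): BX=-X^TB\}$. (1) Let $V$ be an irreducible jet module with finite-dimensional weight spaces. Then there are a finite-dimensional irreducible $T$-module $V_0$ and $\beta\in\mathbb C^N$ such that $V\cong V_0\otimes A$ as $\widetilde H_B\ltimes A$-modules, where $V_0\otimes A$ is a module by $$t^r(v\otimes t^s)=v\otimes t^{s+r},\qquad D(u,0)(v\otimes t^s)=(u|s+\beta)\,v\otimes t^s,$$ $$h_r(v\otimes t^s)=(Br|s+\beta)\,v\otimes t^{s+r}+(T(r)v)\otimes t^{s+r}.$$ (2) There are a surjective Lie algebra homomorphism $\psi_B:T\to\mathfrak G_B$ with $\psi_B(T(r))=r(Br)^T$ for all $r\in\mathbb Z^N$ and a Lie algebra isomorphism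 $\Phi:\mathfrak G_B\to\mathfrak{sp}_{2m}(\mathbb C)$ such that the following hold. - Every finite-dimensional irreducible $T$-module $V_0$ carries an irreducible $\mathfrak{sp}_{2m}$-module structure and admits a Lie algebra homomorphism $\chi:T\to\mathbb C$ such that $x\cdot v=\Phi(\psi_B(x))\cdot v+\chi(x)\,v$ for all $x\in T$, $v\in V_0$. In particular $\ker\psi_B$ acts on $V_0$ by scalars. - Conversely, for every finite-dimensional irreducible $\mathfrak{sp}_{2m}$-module $W$ and every Lie algebra homomorphism $\chi:T\to\mathbb C$ (for instance $\chi=0$), the formula $x\cdot v=\Phi(\psi_B(x))\cdot v+\chi(x)\,v$ makes $W$ an irreducible $T$-module, on which $\ker\psi_B$ acts by scalars. -/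

import Mathlib

open scoped TensorProduct Matrix

universe u v w

attribute [local instance 100] LieRing.ofAssociativeRing

namespace JetModule

noncomputable section

/-- The algebra `A = ℂ[t₁^{±1}, …, t_N^{±1}]` of Laurent polynomials in `N` commuting variables. -/
abbrev Laurent (N : ℕ) : Type := AddMonoidAlgebra ℂ (Fin N → ℤ)

/-- The monomial `t^r`. -/
def mono {N : ℕ} (r : Fin N → ℤ) : Laurent N := AddMonoidAlgebra.single r 1

/-- An integer vector regarded as a complex vector. -/
def cvec {N : ℕ} (r : Fin N → ℤ) : Fin N → ℂ := fun i => (r i : ℂ)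

theorem cvec_add {N : ℕ} (r s : Fin N → ℤ) : cvec (r + s) = cvec r + cvec s := by
  ext i; simp [cvec]

theorem cvec_zero {N : ℕ} : cvec (0 : Fin N → ℤ) = 0 := by
  ext i; simp [cvec]

theorem cvec_neg {N : ℕ} (r : Fin N → ℤ) : cvec (-r) = -cvec r := by
  ext i; simp [cvec]

theorem mono_mul {N : ℕ} (r s : Fin N → ℤ) : mono r * mono s = mono (r + s) := by
  simp [mono, AddMonoidAlgebra.single_mul_single]

theorem mono_zero {N : ℕ} : (mono 0 : Laurent N) = 1 := rfl

theorem laurent_ext {N : ℕ} {M : Type*} [AddCommMonoid M] [Module ℂ M]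
    {f g : Laurent N →ₗ[ℂ] M} (h : ∀ r, f (mono r) = g (mono r)) : f = g := by
  refine AddMonoidAlgebra.lhom_ext' fun r => ?_
  ext
  simpa [mono] using h r

/-- The linear map `t^s ↦ (u|s) t^s`. -/
def degLinear {N : ℕ} (u : Fin N → ℂ) : Laurent N →ₗ[ℂ] Laurent N :=
  (AddMonoidAlgebra.basis (Fin N → ℤ) ℂ).constr ℂ fun s => (u ⬝ᵥ cvec s) • mono s

theorem degLinear_mono {N : ℕ} (u : Fin N → ℂ) (s : Fin N → ℤ) :
    degLinear u (mono s) = (u ⬝ᵥ cvec s) • mono s := by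
  have h : mono s = AddMonoidAlgebra.basis (Fin N → ℤ) ℂ s := by simp [mono]
  rw [degLinear]
  conv_lhs => rw [h]
  rw [Module.Basis.constr_basis]

theorem laurent_induction {N : ℕ} {p : Laurent N → Prop} (hm : ∀ r, p (mono r))
    (hadd : ∀ f g, p f → p g → p (f + g)) (hsmul : ∀ (c : ℂ) f, p f → p (c • f)) (f : Laurent N) :
    p f := by
  have hspan : f ∈ Submodule.span ℂ (Set.range (mono : (Fin N → ℤ) → Laurent N)) := by
    have h := (AddMonoidAlgebra.basis (Fin N → ℤ) ℂ).mem_span f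
    have h2 : (⇑(AddMonoidAlgebra.basis (Fin N → ℤ) ℂ) : (Fin N → ℤ) → Laurent N) = mono := by
      ext1 s; simp [mono]
    rwa [h2] at h
  induction hspan using Submodule.span_induction with
  | mem x hx => obtain ⟨r, rfl⟩ := hx; exact hm r
  | zero => simpa using hsmul 0 _ (hm 0)
  | add x y _ _ hx hy => exact hadd x y hx hy
  | smul c x _ hx => exact hsmul c x hx

/-- The degree derivation `∑ i, u_i d_i` with `d_i = t_i ∂/∂t_i`, that is `t^s ↦ (u|s) t^s`. -/
def degDer {N : ℕ} (u : Fin N → ℂ) : Derivation ℂ (Laurent N) (Laurent N) :=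
  Derivation.mk' (degLinear u) (by
    intro a b
    induction a using laurent_induction with
    | hm r =>
      induction b using laurent_induction with
      | hm s =>
        rw [mono_mul, degLinear_mono, degLinear_mono, degLinear_mono, cvec_add, dotProduct_add,
          smul_eq_mul, smul_eq_mul, mul_smul_comm, mul_smul_comm, mono_mul, mono_mul, add_comm s r,
          add_smul, add_comm]
      | hadd f g hf hg => simp only [mul_add, map_add, hf, hg, smul_eq_mul, add_mul]; abel
      | hsmul c f hf =>
        simp only [mul_smul_comm, map_smul, hf, smul_eq_mul, smul_mul_assoc, smul_add]
    | hadd f g hf hg => simp only [add_mul, map_add, hf, hg, smul_eq_mul, mul_add]; abel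
    | hsmul c f hf =>
      simp only [smul_mul_assoc, map_smul, hf, smul_eq_mul, mul_smul_comm, smul_add])

theorem degDer_mono {N : ℕ} (u : Fin N → ℂ) (s : Fin N → ℤ) :
    degDer u (mono s) = (u ⬝ᵥ cvec s) • mono s := degLinear_mono u s

/-- The derivation `D(u, r) = ∑ i, u_i t^r d_i` of `A`. -/
def D {N : ℕ} (u : Fin N → ℂ) (r : Fin N → ℤ) : Derivation ℂ (Laurent N) (Laurent N) :=
  mono r • degDer u

theorem D_mono {N : ℕ} (u : Fin N → ℂ) (r s : Fin N → ℤ) :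
    D u r (mono s) = (u ⬝ᵥ cvec s) • mono (r + s) := by
  rw [D, Derivation.smul_apply, degDer_mono, smul_eq_mul, mul_smul_comm, mono_mul]

theorem derivation_ext {N : ℕ} {X Y : Derivation ℂ (Laurent N) (Laurent N)}
    (h : ∀ s, X (mono s) = Y (mono s)) : X = Y := by
  ext1 f
  induction f using laurent_induction with
  | hm r => exact h r
  | hadd f g hf hg => rw [map_add, map_add, hf, hg]
  | hsmul c f hf => rw [Derivation.map_smul, Derivation.map_smul, hf]

theorem D_add {N : ℕ} (u v : Fin N → ℂ) (r : Fin N → ℤ) : D (u + v) r = D u r + D v r := by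
  apply derivation_ext; intro s
  rw [Derivation.add_apply, D_mono, D_mono, D_mono, add_dotProduct, add_smul]

theorem D_smul {N : ℕ} (c : ℂ) (u : Fin N → ℂ) (r : Fin N → ℤ) : D (c • u) r = c • D u r := by
  apply derivation_ext; intro s
  rw [Derivation.smul_apply, D_mono, D_mono, smul_dotProduct, smul_assoc]

theorem D_lie {N : ℕ} (u v : Fin N → ℂ) (r s : Fin N → ℤ) :
    ⁅D u r, D v s⁆ = D ((u ⬝ᵥ cvec s) • v - (v ⬝ᵥ cvec r) • u) (r + s) := by
  apply derivation_ext; intro k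
  rw [Derivation.commutator_apply, D_mono, D_mono, D_mono, Derivation.map_smul,
    Derivation.map_smul, D_mono, D_mono,
    cvec_add, cvec_add, add_left_comm s r k, ← add_assoc r s k, smul_smul, smul_smul, ← sub_smul]
  congr 1
  simp only [dotProduct_add, sub_dotProduct, smul_dotProduct, smul_eq_mul]
  ring

section Hamiltonian

variable {N : ℕ} (B : Matrix (Fin N) (Fin N) ℂ)

/-- The subspace `H_B`, spanned by the derivations `h_r = D(Br, r)`. -/
def hSpan : Submodule ℂ (Derivation ℂ (Laurent N) (Laurent N)) :=
  Submodule.span ℂ (Set.range fun r : Fin N → ℤ => D (B *ᵥ cvec r) r)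

/-- The degree derivations `D = span {d_1, …, d_N}`. -/
def dSpan (N : ℕ) : Submodule ℂ (Derivation ℂ (Laurent N) (Laurent N)) :=
  Submodule.span ℂ (Set.range fun i : Fin N => D (Pi.single i 1) 0)

theorem D_zero_mem_dSpan (u : Fin N → ℂ) : D u 0 ∈ dSpan N := by
  have h : D u 0 = ∑ i, u i • D (Pi.single i (1 : ℂ)) (0 : Fin N → ℤ) := by
    let L : (Fin N → ℂ) →ₗ[ℂ] Derivation ℂ (Laurent N) (Laurent N) :=
      { toFun := fun u => D u 0, map_add' := fun u v => D_add u v 0,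
        map_smul' := fun c u => D_smul c u 0 }
    change L u = ∑ i, u i • L (Pi.single i (1 : ℂ))
    conv_lhs => rw [pi_eq_sum_univ' u]
    simp [map_sum, map_smul]
  rw [h]
  exact Submodule.sum_mem _ fun i _ => Submodule.smul_mem _ _ (Submodule.subset_span ⟨i, rfl⟩)

theorem skew_dot {B : Matrix (Fin N) (Fin N) ℂ} (hB : Bᵀ = -B) (x y : Fin N → ℂ) :
    (B *ᵥ x) ⬝ᵥ y = -((B *ᵥ y) ⬝ᵥ x) := by
  rw [dotProduct_comm, Matrix.dotProduct_mulVec, ← Matrix.mulVec_transpose, hB, Matrix.neg_mulVec,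
    neg_dotProduct]

theorem h_lie {B : Matrix (Fin N) (Fin N) ℂ} (hB : Bᵀ = -B) (r s : Fin N → ℤ) :
    ⁅D (B *ᵥ cvec r) r, D (B *ᵥ cvec s) s⁆ =
      ((B *ᵥ cvec r) ⬝ᵥ cvec s) • D (B *ᵥ cvec (r + s)) (r + s) := by
  rw [D_lie, ← D_smul, skew_dot hB (cvec s) (cvec r), cvec_add, Matrix.mulVec_add]
  congr 1
  rw [neg_smul, sub_neg_eq_add, smul_add, add_comm]

theorem d_lie_h (u : Fin N → ℂ) (r : Fin N → ℤ) :
    ⁅D u 0, D (B *ᵥ cvec r) r⁆ = (u ⬝ᵥ cvec r) • D (B *ᵥ cvec r) r := by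
  rw [D_lie, ← D_smul, cvec_zero, dotProduct_zero, zero_smul, sub_zero, zero_add]

theorem d_lie_d (u v : Fin N → ℂ) : ⁅D u (0 : Fin N → ℤ), D v 0⁆ = 0 := by
  rw [D_lie, cvec_zero, dotProduct_zero, dotProduct_zero, zero_smul, zero_smul, sub_zero,
    add_zero, ← zero_smul ℂ (0 : Fin N → ℂ), D_smul, zero_smul]

theorem span_lie_mem {L : Type*} [LieRing L] [LieAlgebra ℂ L] {S : Set L} {P : Submodule ℂ L}
    (h : ∀ x ∈ S, ∀ y ∈ S, ⁅x, y⁆ ∈ P) {x y : L}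
    (hx : x ∈ Submodule.span ℂ S) (hy : y ∈ Submodule.span ℂ S) : ⁅x, y⁆ ∈ P := by
  induction hx using Submodule.span_induction with
  | mem x hx =>
    induction hy using Submodule.span_induction with
    | mem y hy => exact h x hx y hy
    | zero => rw [lie_zero]; exact P.zero_mem
    | add y z _ _ hy hz => rw [lie_add]; exact P.add_mem hy hz
    | smul c y _ hy => rw [lie_smul]; exact P.smul_mem c hy
  | zero => rw [zero_lie]; exact P.zero_mem
  | add x z _ _ hx hz => rw [add_lie]; exact P.add_mem hx hz
  | smul c x _ hx => rw [smul_lie]; exact P.smul_mem c hx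

/-- The Lie algebra `H̃_B = H_B ⊕ D` of derivations of `A`. -/
def HTilde (hB : Bᵀ = -B) : LieSubalgebra ℂ (Derivation ℂ (Laurent N) (Laurent N)) where
  toSubmodule := hSpan B ⊔ dSpan N
  lie_mem' := by
    intro x y hx hy
    have hh : ∀ r : Fin N → ℤ, D (B *ᵥ cvec r) r ∈ hSpan B ⊔ dSpan N := fun r =>
      Submodule.mem_sup_left (Submodule.subset_span ⟨r, rfl⟩)
    change x ∈ hSpan B ⊔ dSpan N at hx
    change y ∈ hSpan B ⊔ dSpan N at hy
    rw [hSpan, dSpan, ← Submodule.span_union] at hx hy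
    refine span_lie_mem ?_ hx hy
    rintro _ (⟨r, rfl⟩ | ⟨i, rfl⟩) _ (⟨s, rfl⟩ | ⟨j, rfl⟩)
    · change ⁅D (B *ᵥ cvec r) r, D (B *ᵥ cvec s) s⁆ ∈ _
      rw [h_lie hB]; exact Submodule.smul_mem _ _ (hh _)
    · change ⁅D (B *ᵥ cvec r) r, D (Pi.single j 1) 0⁆ ∈ _
      rw [← lie_skew, d_lie_h]; exact Submodule.neg_mem _ (Submodule.smul_mem _ _ (hh _))
    · change ⁅D (Pi.single i 1) 0, D (B *ᵥ cvec s) s⁆ ∈ _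
      rw [d_lie_h]; exact Submodule.smul_mem _ _ (hh _)
    · change ⁅D (Pi.single i 1) (0 : Fin N → ℤ), D (Pi.single j 1) 0⁆ ∈ _
      rw [d_lie_d]; exact Submodule.zero_mem _

/-- Derivations of `A` as derivations of `A` regarded as a commutative Lie algebra. -/
def derToLie (N : ℕ) :
    Derivation ℂ (Laurent N) (Laurent N) →ₗ⁅ℂ⁆ LieDerivation ℂ (Laurent N) (Laurent N) where
  toFun X :=
    { toLinearMap := (X : Laurent N →ₗ[ℂ] Laurent N)
      leibniz' := fun a b => by
        simp only [Ring.lie_def, mul_comm, sub_self, map_zero] }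
  map_add' X Y := by ext1 a; rfl
  map_smul' c X := by ext1 a; rfl
  map_lie' := by intro X Y; ext1 a; rfl

/-- The action of `H̃_B` on `A`. -/
def hAction (hB : Bᵀ = -B) : HTilde B hB →ₗ⁅ℂ⁆ LieDerivation ℂ (Laurent N) (Laurent N) :=
  (derToLie N).comp (HTilde B hB).incl

/-- The Lie algebra `H̃_B ⋉ A`, in which `A` is an abelian ideal on which `H̃_B` acts by
derivations. -/
abbrev JetAlg (hB : Bᵀ = -B) : Type := LieAlgebra.SemiDirectSum (Laurent N) (HTilde B hB) (hAction B hB)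

/-- `t^r` as an element of `H̃_B ⋉ A`. -/
def k (hB : Bᵀ = -B) (r : Fin N → ℤ) : JetAlg B hB :=
  LieAlgebra.SemiDirectSum.inl (hAction B hB) (mono r)

/-- `h_r = D(Br, r)` as an element of `H̃_B ⋉ A`. -/
def h (hB : Bᵀ = -B) (r : Fin N → ℤ) : JetAlg B hB :=
  LieAlgebra.SemiDirectSum.inr (hAction B hB)
    ⟨D (B *ᵥ cvec r) r, Submodule.mem_sup_left (Submodule.subset_span ⟨r, rfl⟩)⟩

/-- `D(u, 0)` as an element of `H̃_B ⋉ A`. -/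
def d (hB : Bᵀ = -B) (u : Fin N → ℂ) : JetAlg B hB :=
  LieAlgebra.SemiDirectSum.inr (hAction B hB)
    ⟨D u 0, Submodule.mem_sup_right (D_zero_mem_dSpan u)⟩

theorem lie_k_k (hB : Bᵀ = -B) (r s : Fin N → ℤ) : ⁅k B hB r, k B hB s⁆ = 0 := by
  rw [k, k, ← LieHom.map_lie, Ring.lie_def, mul_comm, sub_self, map_zero]

theorem lie_inr_k (hB : Bᵀ = -B) (X : HTilde B hB) (s : Fin N → ℤ) :
    ⁅LieAlgebra.SemiDirectSum.inr (hAction B hB) X, k B hB s⁆ =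
      LieAlgebra.SemiDirectSum.inl (hAction B hB)
        ((X : Derivation ℂ (Laurent N) (Laurent N)) (mono s)) := by
  ext1
  · simp [k, LieAlgebra.SemiDirectSum.lie_eq_mk]; rfl
  · simp [k, LieAlgebra.SemiDirectSum.lie_eq_mk]

theorem lie_h_k (hB : Bᵀ = -B) (r s : Fin N → ℤ) :
    ⁅h B hB r, k B hB s⁆ = ((B *ᵥ cvec r) ⬝ᵥ cvec s) • k B hB (r + s) := by
  rw [h, lie_inr_k, k, ← map_smul, ← D_mono]

theorem lie_d_k (hB : Bᵀ = -B) (u : Fin N → ℂ) (s : Fin N → ℤ) :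
    ⁅d B hB u, k B hB s⁆ = (u ⬝ᵥ cvec s) • k B hB s := by
  rw [d, lie_inr_k, k, ← map_smul, D_mono, zero_add]

theorem lie_h_h (hB : Bᵀ = -B) (r s : Fin N → ℤ) :
    ⁅h B hB r, h B hB s⁆ = ((B *ᵥ cvec r) ⬝ᵥ cvec s) • h B hB (r + s) := by
  rw [h, h, h, ← LieHom.map_lie, ← map_smul]
  congr 1
  exact Subtype.ext (h_lie hB r s)

theorem lie_d_h (hB : Bᵀ = -B) (u : Fin N → ℂ) (r : Fin N → ℤ) :
    ⁅d B hB u, h B hB r⁆ = (u ⬝ᵥ cvec r) • h B hB r := by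
  rw [d, h, ← LieHom.map_lie, ← map_smul]
  congr 1
  exact Subtype.ext (d_lie_h B u r)

theorem lie_d_d (hB : Bᵀ = -B) (u v : Fin N → ℂ) : ⁅d B hB u, d B hB v⁆ = 0 := by
  rw [d, d, ← LieHom.map_lie, ← map_zero (LieAlgebra.SemiDirectSum.inr (hAction B hB))]
  congr 1
  exact Subtype.ext (d_lie_d u v)

theorem d_add (hB : Bᵀ = -B) (u v : Fin N → ℂ) : d B hB (u + v) = d B hB u + d B hB v := by
  rw [d, d, d, ← map_add]
  congr 1
  exact Subtype.ext (D_add u v 0)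

/-- The relations `t^r t^s = t^{r+s}` and `t^0 = 1` in the enveloping algebra of `H̃_B ⋉ A`. -/
inductive JetRel (hB : Bᵀ = -B) : UniversalEnvelopingAlgebra ℂ (JetAlg B hB) →
    UniversalEnvelopingAlgebra ℂ (JetAlg B hB) → Prop
  | mul (r s : Fin N → ℤ) : JetRel hB
      (UniversalEnvelopingAlgebra.ι ℂ (k B hB r) * UniversalEnvelopingAlgebra.ι ℂ (k B hB s))
      (UniversalEnvelopingAlgebra.ι ℂ (k B hB (r + s)))
  | one : JetRel hB (UniversalEnvelopingAlgebra.ι ℂ (k B hB 0)) 1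

/-- The associative algebra `U' = U / L`, where `U` is the universal enveloping algebra of
`H̃_B ⋉ A` and `L` is the two-sided ideal generated by all `t^r t^s - t^{r+s}` and `t^0 - 1`. -/
abbrev JetEnv (hB : Bᵀ = -B) : Type := RingQuot (JetRel B hB)

/-- The canonical map `H̃_B ⋉ A → U'`. -/
def toEnv (hB : Bᵀ = -B) : JetAlg B hB →ₗ⁅ℂ⁆ JetEnv B hB :=
  (AlgHom.toLieHom (RingQuot.mkAlgHom ℂ (JetRel B hB))).comp
    (UniversalEnvelopingAlgebra.ι ℂ)

/-- The element `T(r) = t^{-r} h_r - D(Br, 0)` of `U'`. -/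
def TElem (hB : Bᵀ = -B) (r : Fin N → ℤ) : JetEnv B hB :=
  toEnv B hB (k B hB (-r)) * toEnv B hB (h B hB r) - toEnv B hB (d B hB (B *ᵥ cvec r))

theorem toEnv_lie (hB : Bᵀ = -B) (x y : JetAlg B hB) :
    toEnv B hB x * toEnv B hB y = toEnv B hB y * toEnv B hB x + toEnv B hB ⁅x, y⁆ := by
  rw [LieHom.map_lie, Ring.lie_def]; abel

theorem toEnv_k_mul (hB : Bᵀ = -B) (r s : Fin N → ℤ) :
    toEnv B hB (k B hB r) * toEnv B hB (k B hB s) = toEnv B hB (k B hB (r + s)) := by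
  have h1 := RingQuot.mkAlgHom_rel ℂ (JetRel.mul (B := B) (hB := hB) r s)
  rw [map_mul] at h1
  exact h1

theorem toEnv_k_zero (hB : Bᵀ = -B) : toEnv B hB (k B hB 0) = 1 := by
  have h1 := RingQuot.mkAlgHom_rel ℂ (JetRel.one (B := B) (hB := hB))
  rw [map_one] at h1
  exact h1

theorem toEnv_X_mul (hB : Bᵀ = -B) (r s : Fin N → ℤ) :
    (toEnv B hB (k B hB (-r)) * toEnv B hB (h B hB r)) *
      (toEnv B hB (k B hB (-s)) * toEnv B hB (h B hB s)) =
    toEnv B hB (k B hB (-(r + s))) * (toEnv B hB (h B hB r) * toEnv B hB (h B hB s)) -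
      ((B *ᵥ cvec r) ⬝ᵥ cvec s) • (toEnv B hB (k B hB (-s)) * toEnv B hB (h B hB s)) := by
  have e1 : toEnv B hB (h B hB r) * toEnv B hB (k B hB (-s)) =
      toEnv B hB (k B hB (-s)) * toEnv B hB (h B hB r) -
        ((B *ᵥ cvec r) ⬝ᵥ cvec s) • toEnv B hB (k B hB (r + -s)) := by
    rw [toEnv_lie, lie_h_k, map_smul, cvec_neg, dotProduct_neg, neg_smul, sub_eq_add_neg]
  calc _ = toEnv B hB (k B hB (-r)) * (toEnv B hB (h B hB r) * toEnv B hB (k B hB (-s))) *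
        toEnv B hB (h B hB s) := by simp only [mul_assoc]
    _ = (toEnv B hB (k B hB (-r)) * toEnv B hB (k B hB (-s))) *
          (toEnv B hB (h B hB r) * toEnv B hB (h B hB s)) -
        ((B *ᵥ cvec r) ⬝ᵥ cvec s) • ((toEnv B hB (k B hB (-r)) * toEnv B hB (k B hB (r + -s))) *
          toEnv B hB (h B hB s)) := by
      rw [e1, mul_sub, sub_mul, mul_smul_comm, smul_mul_assoc]
      simp only [mul_assoc]
    _ = _ := by
      rw [toEnv_k_mul, toEnv_k_mul, neg_add_cancel_left, neg_add]

theorem toEnv_d_comm (hB : Bᵀ = -B) (u : Fin N → ℂ) (s : Fin N → ℤ) :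
    toEnv B hB (d B hB u) * (toEnv B hB (k B hB (-s)) * toEnv B hB (h B hB s)) =
      (toEnv B hB (k B hB (-s)) * toEnv B hB (h B hB s)) * toEnv B hB (d B hB u) := by
  rw [← mul_assoc, toEnv_lie, lie_d_k, add_mul, mul_assoc, toEnv_lie B hB (d B hB u), lie_d_h,
    map_smul, map_smul, mul_add, mul_smul_comm, smul_mul_assoc, cvec_neg, dotProduct_neg, neg_smul,
    mul_assoc]
  abel

theorem TElem_lie (hB : Bᵀ = -B) (r s : Fin N → ℤ) :
    ⁅TElem B hB r, TElem B hB s⁆ = ((B *ᵥ cvec r) ⬝ᵥ cvec s) •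
      (TElem B hB (r + s) - TElem B hB r - TElem B hB s) := by
  have e1 := toEnv_X_mul B hB r s
  have e2 := toEnv_X_mul B hB s r
  have e3 := toEnv_lie B hB (h B hB r) (h B hB s)
  have e4 := toEnv_d_comm B hB (B *ᵥ cvec r) s
  have e5 := toEnv_d_comm B hB (B *ᵥ cvec s) r
  have e6 := toEnv_lie B hB (d B hB (B *ᵥ cvec r)) (d B hB (B *ᵥ cvec s))
  rw [lie_d_d, map_zero, add_zero] at e6
  rw [lie_h_h, map_smul] at e3
  rw [skew_dot hB (cvec s) (cvec r), add_comm s r, neg_smul, sub_neg_eq_add] at e2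
  rw [e3, mul_add, mul_smul_comm] at e1
  have e7 : toEnv B hB (d B hB (B *ᵥ cvec (r + s))) =
      toEnv B hB (d B hB (B *ᵥ cvec r)) + toEnv B hB (d B hB (B *ᵥ cvec s)) := by
    rw [cvec_add, Matrix.mulVec_add, d_add, map_add]
  rw [Ring.lie_def]
  simp only [TElem, e7, sub_mul, mul_sub, e1, e2, e4, e5, e6, smul_sub, smul_add]
  abel

/-- The Lie algebra `T`, the span of the elements `T(r)` in `U'` with the commutator bracket. -/
def TAlg (hB : Bᵀ = -B) : LieSubalgebra ℂ (JetEnv B hB) where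
  toSubmodule := Submodule.span ℂ (Set.range (TElem B hB))
  lie_mem' := by
    intro x y hx hy
    have hT : ∀ r, TElem B hB r ∈ Submodule.span ℂ (Set.range (TElem B hB)) := fun r =>
      Submodule.subset_span ⟨r, rfl⟩
    refine span_lie_mem ?_ hx hy
    rintro _ ⟨r, rfl⟩ _ ⟨s, rfl⟩
    rw [TElem_lie]
    exact Submodule.smul_mem _ _ (Submodule.sub_mem _ (Submodule.sub_mem _ (hT _) (hT _)) (hT _))

/-- `T(r)` as an element of `T`. -/
def T (hB : Bᵀ = -B) (r : Fin N → ℤ) : TAlg B hB :=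
  ⟨TElem B hB r, Submodule.subset_span ⟨r, rfl⟩⟩

/-- The Lie algebra `𝔊_B = {X : B X = - Xᵀ B}`. -/
abbrev GB : LieSubalgebra ℂ (Matrix (Fin N) (Fin N) ℂ) := skewAdjointMatricesLieSubalgebra B

theorem mem_GB (X : Matrix (Fin N) (Fin N) ℂ) : X ∈ GB B ↔ B * X = -(Xᵀ * B) := by
  rw [mem_skewAdjointMatricesLieSubalgebra, mem_skewAdjointMatricesSubmodule,
    Matrix.IsSkewAdjoint, Matrix.IsAdjointPair, Matrix.mul_neg, eq_neg_iff_add_eq_zero,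
    eq_neg_iff_add_eq_zero, add_comm]

/-- The rank one matrix `r (Br)ᵀ`. -/
def rankOne (r : Fin N → ℤ) : Matrix (Fin N) (Fin N) ℂ :=
  Matrix.vecMulVec (cvec r) (B *ᵥ cvec r)

section Modules

variable {B} (hB : Bᵀ = -B) (V : Type*) [AddCommGroup V] [Module ℂ V]
  [LieRingModule (JetAlg B hB) V] [LieModule ℂ (JetAlg B hB) V]

/-- `V` is a jet module: `A` acts associatively, with `t^0` acting as the identity. -/
def IsJetModule : Prop :=
  (∀ (r s : Fin N → ℤ) (v : V), ⁅k B hB r, ⁅k B hB s, v⁆⁆ = ⁅k B hB (r + s), v⁆) ∧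
    ∀ v : V, ⁅k B hB 0, v⁆ = v

/-- The weight space of all `v` with `D(u, 0) v = (u|μ) v` for all `u ∈ ℂ^N`. -/
def weightSpace (μ : Fin N → ℂ) : Submodule ℂ V where
  carrier := {v | ∀ u : Fin N → ℂ, ⁅d B hB u, v⁆ = (u ⬝ᵥ μ) • v}
  add_mem' := by intro v w hv hw u; rw [lie_add, hv u, hw u, smul_add]
  zero_mem' := by intro u; rw [lie_zero, smul_zero]
  smul_mem' := by intro c v hv u; rw [lie_smul, hv u, smul_comm]

/-- `V` is the (automatically direct) sum of its weight spaces, all of finite dimension. -/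
def HasFiniteDimWeightSpaces : Prop :=
  (⨆ μ, weightSpace hB V μ) = ⊤ ∧ ∀ μ, FiniteDimensional ℂ (weightSpace hB V μ)

variable (V₀ : Type*) [AddCommGroup V₀] [Module ℂ V₀] [LieRingModule (TAlg B hB) V₀]
  [LieModule ℂ (TAlg B hB) V₀]

/-- The given action of `H̃_B ⋉ A` on `V₀ ⊗ A` is the one determined by the `T`-module `V₀` and
`β ∈ ℂ^N`, so that `T(r) = t^{-r} h_r - D(Br, 0)` acts through `V₀`. -/
def IsTensorAction [LieRingModule (JetAlg B hB) (V₀ ⊗[ℂ] Laurent N)] (β : Fin N → ℂ) : Prop :=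
  ∀ (v : V₀) (s : Fin N → ℤ),
    (∀ r : Fin N → ℤ, ⁅k B hB r, v ⊗ₜ[ℂ] (mono s : Laurent N)⁆ = v ⊗ₜ[ℂ] mono (s + r)) ∧
    (∀ u : Fin N → ℂ, ⁅d B hB u, v ⊗ₜ[ℂ] (mono s : Laurent N)⁆ =
      (u ⬝ᵥ (cvec s + β)) • (v ⊗ₜ[ℂ] mono s)) ∧
    ∀ r : Fin N → ℤ, ⁅h B hB r, v ⊗ₜ[ℂ] (mono s : Laurent N)⁆ =
      ((B *ᵥ cvec r) ⬝ᵥ (cvec s + β)) • (v ⊗ₜ[ℂ] mono (s + r)) + ⁅T B hB r, v⁆ ⊗ₜ[ℂ] mono (s + r)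

end Modules

end Hamiltonian

end

end JetModule

/-! Part (1). Fix a non-zero weight space `V_β`. Each `t^s` is invertible and moves `V_β` to weight
`β + s`; these weights are distinct, so `V_β ⊗ A → V`, `v ⊗ f ↦ f v`, is injective
(`evalMap_injective`). The operators `T(r) = t^{-r} h_r - D(Br, 0)` preserve `V_β`, and `h_r` acts
on `t^s V_β` through them (`lie_h_lie_k`). Hence the monomial translates of a non-zero `T`-stable
subspace of `V_β` span a submodule, that is, all of `V`. This gives surjectivity and the
irreducibility of `V_β` over `T`.

Part (2). Split a finite-dimensional irreducible `T`-module into a trace-free part and a character.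
The image `L` of the trace-free part is a finite-dimensional Lie algebra with trivial radical,
spanned by the images of the `T(r)`, which still satisfy `[T r, T s] = ω(r, s) (T(r+s) - T r - T
s)`. The heart of the proof is that in such an `L` the map `r ↦ T r` is quadratic
(`IsHamiltonianFamily.parallelogram`): - every `ad T(s)` is nilpotent (`mem_engel`), by an
eigenvalue argument with `T(s)` and `T(2s)`; - `ad T(s)` acts on finite differences of `T` in
direction `s` by raising their order, so `n ↦ T(r + ns)`, and then `n ↦ T(ns)` for `n ≥ 1`, is
polynomial; - write `c_j(s)` for the coefficient of `n^j` in `T(ns)`. Then `[c_i, c_j]` lies in the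
span of the `c_{i+j-2}`. The `c_0` and then the `c_1` are central, and the top `c_k` with `k ≥ 3`
span an abelian ideal, so only `c_2` survives; - `T(2s) = 4 T(s)` and the bracket relation give the
parallelogram law.

A quadratic map is linear in the products `r_i r_j`, and these are recovered from `r (Br)ᵀ` because
`B` is invertible. So the trace-free part vanishes on `ker ψ_B` and factors through `𝔊_B`, which a
symplectic basis identifies with `sp_{2m}`. The converse is pullback along a surjection twisted by a
character. -/

/-! ### Polynomials with coefficients in a complex vector space or Lie algebra. -/

namespace PolynomialModule

variable {M : Type*} [AddCommGroup M] [Module ℂ M]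

/-- Linear functionals reduce this to scalar polynomials with infinitely many roots. Only `n ≥ 1` is
assumed because the polynomial for `T(ns)` is obtained by cancelling a factor `n`. -/
theorem eq_zero_of_eval_natCast_eq_zero (p : PolynomialModule ℂ M)
    (hp : ∀ n : ℕ, 1 ≤ n → eval (n : ℂ) p = 0) : p = 0 := by
  have key : ∀ φ : Module.Dual ℂ M, map ℂ φ p = 0 := by
    intro φ
    have h : equivPolynomial (map ℂ φ p) = 0 := by
      refine Polynomial.eq_zero_of_infinite_isRoot _ ?_
      refine Set.Infinite.mono (s := Set.range fun n : ℕ => ((n + 1 : ℕ) : ℂ)) ?_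
        (Set.infinite_range_of_injective fun a b hab => by simpa using hab)
      rintro _ ⟨n, rfl⟩
      have := aeval_equivPolynomial (map ℂ φ p) ((n + 1 : ℕ) : ℂ)
      have h2 := eval_map ℂ φ p ((n + 1 : ℕ) : ℂ)
      rw [hp _ (by omega), map_zero] at h2
      change Polynomial.eval _ _ = 0
      rw [← Polynomial.coe_aeval_eq_eval, this]
      have h3 : map ℂ (Algebra.linearMap ℂ ℂ) (map ℂ φ p) = map ℂ φ p := by
        generalize map ℂ φ p = q
        ext j
        simp [map]
      rw [h3]
      exact h2
    simpa using h
  ext j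
  rw [← sub_eq_zero, coeff_zero, Finsupp.coe_zero, Pi.zero_apply, sub_zero,
    ← Module.forall_dual_apply_eq_zero_iff ℂ]
  intro φ
  have := congrArg (fun q => q.coeff j) (key φ)
  simpa [map] using this

theorem ext_eval_natCast {p q : PolynomialModule ℂ M}
    (hpq : ∀ n : ℕ, 1 ≤ n → eval (n : ℂ) p = eval (n : ℂ) q) : p = q :=
  sub_eq_zero.mp <| eq_zero_of_eval_natCast_eq_zero _ fun n hn => by
    rw [map_sub, hpq n hn, sub_self]

theorem coeff_map (φ : M →ₗ[ℂ] M) (p : PolynomialModule ℂ M) (j : ℕ) :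
    (map ℂ φ p).coeff j = φ (p.coeff j) := by
  simp [map]

/-- Modulo `S` all the values vanish, hence so do all the coefficients. -/
theorem coeff_mem_of_eval_mem (S : Submodule ℂ M) (p : PolynomialModule ℂ M)
    (hp : ∀ n : ℕ, 1 ≤ n → eval (n : ℂ) p ∈ S) (j : ℕ) : p.coeff j ∈ S := by
  have h : map ℂ S.mkQ p = 0 := by
    refine eq_zero_of_eval_natCast_eq_zero _ fun n hn => ?_
    have := eval_map ℂ S.mkQ p (n : ℂ)
    rw [Algebra.algebraMap_self, RingHom.id_apply] at this
    rw [this]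
    simpa using hp n hn
  have := congrArg (fun q => q.coeff j) h
  simpa [map] using this

theorem eval_X_smul (p : PolynomialModule ℂ M) (x : ℂ) :
    eval x ((Polynomial.X : Polynomial ℂ) • p) = x • eval x p := by
  simp

theorem coeff_X_smul_zero (p : PolynomialModule ℂ M) :
    ((Polynomial.X : Polynomial ℂ) • p).coeff 0 = 0 := by
  rw [← Polynomial.monomial_one_one_eq_X, monomial_smul_apply]; simp

theorem coeff_X_smul_succ (p : PolynomialModule ℂ M) (j : ℕ) :
    ((Polynomial.X : Polynomial ℂ) • p).coeff (j + 1) = p.coeff j := by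
  rw [← Polynomial.monomial_one_one_eq_X, monomial_smul_apply]; simp

theorem eval_zero_eq_coeff (p : PolynomialModule ℂ M) : eval (0 : ℂ) p = p.coeff 0 := by
  induction p using induction_linear with
  | zero => simp
  | add p q hp hq => simp [hp, hq]
  | single n m =>
    rcases n with _ | n <;> simp

theorem exists_X_smul_of_coeff_zero (D : ℕ) (p : PolynomialModule ℂ M) (h0 : p.coeff 0 = 0)
    (hD : ∀ j, D < j → p.coeff j = 0) :
    ∃ q : PolynomialModule ℂ M, (Polynomial.X : Polynomial ℂ) • q = p ∧
      ∀ j, D ≤ j → q.coeff j = 0 := by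
  refine ⟨.ofCoeff ℂ (p.coeff.comapDomain (· + 1) (fun a _ b _ h => by simpa using h)), ?_, ?_⟩
  · ext j
    rcases j with _ | j
    · rw [coeff_X_smul_zero, h0]
    · rw [coeff_X_smul_succ]; exact Finsupp.comapDomain_apply _ _ _ _
  · intro j hj
    exact (Finsupp.comapDomain_apply _ _ _ _).trans (hD (j + 1) (by omega))

/-- The Cauchy product for the bracket: it lets bracket identities valid at every `n` be compared
coefficient by coefficient. -/
theorem exists_lie {L : Type*} [LieRing L] [LieAlgebra ℂ L] (p q : PolynomialModule ℂ L) :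
    ∃ z : PolynomialModule ℂ L, (∀ x : ℂ, eval x z = ⁅eval x p, eval x q⁆) ∧
      ∀ m, z.coeff m =
        ∑ ij ∈ Finset.HasAntidiagonal.antidiagonal m, ⁅p.coeff ij.1, q.coeff ij.2⁆ := by
  induction p using induction_linear with
  | zero => exact ⟨0, by simp, by simp⟩
  | add p p' hp hp' =>
    obtain ⟨z, h1, h2⟩ := hp
    obtain ⟨z', h1', h2'⟩ := hp'
    exact ⟨z + z', by simp [h1, h1'], by simp [h2, h2', Finset.sum_add_distrib]⟩
  | single i a =>
    induction q using induction_linear with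
    | zero => exact ⟨0, by simp, by simp⟩
    | add p p' hp hp' =>
      obtain ⟨z, h1, h2⟩ := hp
      obtain ⟨z', h1', h2'⟩ := hp'
      exact ⟨z + z', by simp [h1, h1'], by simp [h2, h2', Finset.sum_add_distrib]⟩
    | single j b =>
      refine ⟨single ℂ (i + j) ⁅a, b⁆, fun x => ?_, fun m => ?_⟩
      · simp only [eval_single, smul_lie, lie_smul, smul_smul, pow_add, mul_comm]
      · simp only [coeff_single, Finsupp.single_apply]
        split_ifs with h
        · rw [Finset.sum_eq_single (i, j)]
          · simp
          · rintro ⟨k, l⟩ - hne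
            rcases eq_or_ne i k with rfl | hik
            · rw [if_neg (c := j = l), lie_zero]
              rintro rfl; exact hne rfl
            · rw [if_neg hik, zero_lie]
          · intro hh; simp [h] at hh
        · rw [Finset.sum_eq_zero]
          rintro ⟨k, l⟩ hkl
          rw [Finset.HasAntidiagonal.mem_antidiagonal] at hkl
          rcases eq_or_ne i k with rfl | hik
          · rw [if_neg (c := j = l), lie_zero]
            rintro rfl; exact h hkl
          · rw [if_neg hik, zero_lie]

end PolynomialModule

/-! ### Commuting pencils and avoidance of finite sets. -/

/-- For commuting operators `A`, `E` of a finite-dimensional space, the pencil `2 A² + c E` has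
kernel inside the generalized null space of `A` for all but finitely many `c`. -/
theorem Module.End.finite_setOf_pencil {V : Type*} [AddCommGroup V] [Module ℂ V]
    [FiniteDimensional ℂ V] (A E : Module.End ℂ V) (hAE : Commute A E) :
    {c : ℂ | ∃ w, (∀ n, (A ^ n) w ≠ 0) ∧ (2 : ℂ) • A (A w) + c • E w = 0}.Finite := by
  have hfA : {x | A.HasEigenvalue x}.Finite := Module.End.finite_hasEigenvalue A
  have hfE : {x | E.HasEigenvalue x}.Finite := Module.End.finite_hasEigenvalue E
  -- A common eigenvector with eigenvalues `x` of `A` and `y` of `E` forces `2x² + cy = 0`, and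
  -- there are finitely many pairs `(x, y)`.
  refine ((hfA.prod hfE).image fun xy : ℂ × ℂ => -(2 * xy.1 ^ 2) / xy.2).subset ?_
  rintro c ⟨w, hw, hwc⟩
  let K : Submodule ℂ V := LinearMap.ker ((2 : ℂ) • (A * A) + c • E)
  have hcomm : Commute A ((2 : ℂ) • (A * A) + c • E) :=
    (((Commute.refl A).mul_right (Commute.refl A)).smul_right _).add_right (hAE.smul_right _)
  have hcommE : Commute E ((2 : ℂ) • (A * A) + c • E) :=
    ((hAE.symm.mul_right hAE.symm).smul_right _).add_right ((Commute.refl E).smul_right _)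
  have inv : ∀ F : Module.End ℂ V, Commute F ((2 : ℂ) • (A * A) + c • E) →
      ∀ x ∈ K, F x ∈ K := by
    intro F hF x hx
    rw [LinearMap.mem_ker] at hx ⊢
    rw [← Module.End.mul_apply, ← hF.eq, Module.End.mul_apply, hx, map_zero]
  let AK : Module.End ℂ K := A.restrict (inv A hcomm)
  have hwK : w ∈ K := by
    rw [LinearMap.mem_ker]; simpa using hwc
  -- If `0` were the only eigenvalue of `A` on the kernel `K`, then `A` would be nilpotent there,
  -- against `A ^ n w ≠ 0`.
  have hex : ∃ x : ℂ, x ≠ 0 ∧ AK.HasEigenvalue x := by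
    by_contra! hno
    have htop := Module.End.iSup_maxGenEigenspace_eq_top AK
    have h0 : (⨆ x : ℂ, AK.maxGenEigenspace x) ≤ AK.maxGenEigenspace 0 := by
      refine iSup_le fun x => ?_
      by_cases hx : x = 0
      · rw [hx]
      · have : AK.maxGenEigenspace x = ⊥ := by
          by_contra hne
          obtain ⟨y, hy, hy0⟩ := Submodule.exists_mem_ne_zero_of_ne_bot hne
          apply hno x hx
          refine Module.End.hasEigenvalue_of_hasGenEigenvalue (k := Module.finrank ℂ K) ?_
          rw [Module.End.HasGenEigenvalue, Module.End.HasUnifEigenvalue]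
          rw [Module.End.maxGenEigenspace_eq_genEigenspace_finrank] at hne
          exact hne
        rw [this]; exact bot_le
    rw [htop] at h0
    have hmem := h0 (Submodule.mem_top (x := (⟨w, hwK⟩ : K)))
    rw [Module.End.mem_maxGenEigenspace] at hmem
    obtain ⟨n, hn⟩ := hmem
    apply hw n
    rw [zero_smul, sub_zero] at hn
    have := congrArg Subtype.val hn
    rw [Module.End.pow_restrict n] at this
    simpa using this
  obtain ⟨x, hx0, hx⟩ := hex
  obtain ⟨v, hv⟩ := hx.exists_hasEigenvector
  have hv1 : A (v : V) = x • (v : V) := congrArg Subtype.val hv.apply_eq_smul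
  have hvne : (v : V) ≠ 0 := fun h => hv.2 (Subtype.ext h)
  have hv2 : (2 : ℂ) • A (A (v : V)) + c • E (v : V) = 0 := by
    exact LinearMap.mem_ker.mp v.2
  rw [hv1, map_smul, hv1, smul_smul, smul_smul] at hv2
  -- With `c ≠ 0` the pencil equation itself makes `v` an eigenvector of `E`, so no simultaneous
  -- diagonalisation is needed.
  have hc : c ≠ 0 := by
    rintro rfl
    rw [zero_smul, add_zero] at hv2
    rcases smul_eq_zero.mp hv2 with h | h
    · apply hx0; simpa using h
    · exact hvne h
  have hE : E (v : V) = (-(2 * x ^ 2) / c) • (v : V) := by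
    have : c • E (v : V) = (-(2 * x ^ 2)) • (v : V) := by
      rw [eq_comm, ← sub_eq_zero, ← neg_eq_zero, ← hv2]; module
    rw [div_eq_inv_mul, mul_smul, ← this, smul_smul, inv_mul_cancel₀ hc, one_smul]
  refine ⟨(x, -(2 * x ^ 2) / c), ⟨?_, ?_⟩, ?_⟩
  · exact Module.End.hasEigenvalue_of_hasEigenvector ⟨Module.End.mem_eigenspace_iff.mpr hv1, hvne⟩
  · exact Module.End.hasEigenvalue_of_hasEigenvector ⟨Module.End.mem_eigenspace_iff.mpr hE, hvne⟩
  · field_simp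

theorem Complex.exists_natCast_notMem {F : Set ℂ} (hF : F.Finite) : ∃ n : ℕ, (n : ℂ) ∉ F := by
  obtain ⟨_, ⟨n, rfl⟩, hn⟩ := (Set.infinite_range_of_injective (f := fun n : ℕ => (n : ℂ))
    Nat.cast_injective).exists_notMem_finset hF.toFinset
  exact ⟨n, by simpa using hn⟩

namespace PolynomialModule

variable {M : Type*} [AddCommGroup M] [Module ℂ M]

theorem coeff_comp_C_mul_X (b : ℂ) (q : PolynomialModule ℂ M) (j : ℕ) :
    (comp (Polynomial.C b * Polynomial.X) q).coeff j = b ^ j • q.coeff j := by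
  induction q using induction_linear with
  | zero => simp
  | add p q hp hq => rw [map_add, coeff_add, coeff_add, Finsupp.add_apply, hp, hq,
      Finsupp.add_apply, smul_add]
  | single i m =>
    rw [comp_single, mul_pow, ← Polynomial.C_pow, Polynomial.C_mul_X_pow_eq_monomial,
      monomial_smul_single, add_zero, coeff_single, coeff_single, Finsupp.single_apply,
      Finsupp.single_apply]
    split_ifs with h
    · rw [h]
    · rw [smul_zero]

theorem eval_mem_of_coeff_mem (S : Submodule ℂ M) (p : PolynomialModule ℂ M)
    (hp : ∀ j, p.coeff j ∈ S) (x : ℂ) : eval x p ∈ S := by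
  rw [eval_apply]
  exact Submodule.sum_mem _ fun i _ => S.smul_mem _ (hp i)

end PolynomialModule

/-! ### Hamiltonian families and the nilpotency of `ad T(s)`. -/

/-- A family of elements `T r` of a Lie algebra, indexed by an abelian group with a
non-degenerate alternating form `ω`, spanning it and satisfying
`[T r, T s] = ω r s (T (r + s) - T r - T s)`. -/
structure IsHamiltonianFamily {G L : Type*} [AddCommGroup G] [LieRing L] [LieAlgebra ℂ L]
    (ω : G →+ G →+ ℂ) (T : G → L) : Prop where
  alt : ∀ x, ω x x = 0
  nondeg : ∀ x, x ≠ 0 → ∃ t, ω t x ≠ 0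
  apply_zero : T 0 = 0
  lie : ∀ r s, ⁅T r, T s⁆ = ω r s • (T (r + s) - T r - T s)
  span : Submodule.span ℂ (Set.range T) = ⊤

namespace IsHamiltonianFamily

open PolynomialModule

variable {G L : Type*} [AddCommGroup G] [LieRing L] [LieAlgebra ℂ L]
  {ω : G →+ G →+ ℂ} {T : G → L}

theorem skew (hT : IsHamiltonianFamily ω T) (x y : G) : ω x y = -ω y x := by
  have := hT.alt (x + y)
  simp only [map_add, AddMonoidHom.add_apply, hT.alt] at this
  linear_combination this

/-- A perturbation `t + n t'` keeps the pairings already non-zero and gains the new one, for all but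
finitely many `n`. This supplies vectors in general position. -/
theorem exists_forall_ne_zero (hT : IsHamiltonianFamily ω T) (S : Finset G)
    (hS : ∀ x ∈ S, x ≠ 0) : ∃ t, ∀ x ∈ S, ω t x ≠ 0 := by
  classical
  induction S using Finset.induction_on with
  | empty => exact ⟨0, by simp⟩
  | insert a S ha ih =>
    obtain ⟨t, ht⟩ := ih fun x hx => hS x (Finset.mem_insert_of_mem hx)
    obtain ⟨t', ht'⟩ := hT.nondeg a (hS a (Finset.mem_insert_self _ _))
    obtain ⟨n, hn⟩ := Complex.exists_natCast_notMem
      ((insert a S).image fun x => -(ω t x) / ω t' x).finite_toSet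
    refine ⟨t + n • t', fun x hx h0 => ?_⟩
    rw [map_add, AddMonoidHom.add_apply, map_nsmul, AddMonoidHom.nsmul_apply, nsmul_eq_mul] at h0
    by_cases h : ω t' x = 0
    · rw [h, mul_zero, add_zero] at h0
      rcases Finset.mem_insert.mp hx with rfl | hx
      · exact ht' h
      · exact ht x hx h0
    · refine hn (Finset.mem_coe.mpr (Finset.mem_image.mpr ⟨x, hx, ?_⟩))
      field_simp
      linear_combination -h0

/-- With `A = ad T(s)` and `A' = ad T(2s)`, this says that `w = [T s, T r]` is killed by `2A² + c(4A
- A')` for `c = ω(s, r)`, an instance of the pencil above. -/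
theorem pencil_lie (hT : IsHamiltonianFamily ω T) (s r : G) :
    (2 : ℂ) • ⁅T s, ⁅T s, ⁅T s, T r⁆⁆⁆ +
      ω s r • ((4 : ℂ) • ⁅T s, ⁅T s, T r⁆⁆ - ⁅T (s + s), ⁅T s, T r⁆⁆) = 0 := by
  have e0 : ⁅T s, T r⁆ = ω s r • (T (r + s) - T s - T r) := by rw [hT.lie, add_comm s r]
  have e1 : ⁅T s, T (r + s)⁆ = ω s r • (T (r + s + s) - T s - T (r + s)) := by
    rw [hT.lie, add_comm s (r + s), map_add, hT.alt, add_zero]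
  have e2 : ⁅T s, T (r + s + s)⁆ = ω s r • (T (r + s + s + s) - T s - T (r + s + s)) := by
    rw [hT.lie, add_comm s (r + s + s), map_add, map_add, hT.alt, add_zero, add_zero]
  have f0 : ⁅T (s + s), T r⁆ = (2 * ω s r) • (T (r + s + s) - T (s + s) - T r) := by
    rw [hT.lie, add_comm (s + s) r, add_assoc, map_add, AddMonoidHom.add_apply, two_mul]
  have f1 : ⁅T (s + s), T (r + s)⁆ = (2 * ω s r) • (T (r + s + s + s) - T (s + s) - T (r + s)) := by
    rw [hT.lie, add_comm (s + s) (r + s), ← add_assoc]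
    simp only [map_add, AddMonoidHom.add_apply, hT.alt, two_mul, add_zero]
  have f2 : ⁅T (s + s), T s⁆ = 0 := by
    rw [hT.lie, map_add, AddMonoidHom.add_apply, hT.alt, add_zero, zero_smul]
  simp only [e0, e1, e2, f0, f1, f2, lie_self, lie_zero, lie_smul, lie_sub]
  module

section FiniteDimensional

variable [FiniteDimensional ℂ L]

/-- If `ω(s, r)` avoids the finite exceptional set of the pencil, then `[T s, T r]`, and with it `T
r`, is killed by a power of `ad T(s)`. Any other `r` is split as `nt + (r - nt)` with both pieces
generic; the Engel subalgebra is closed under brackets, and `[T(nt), T(r - nt)]` contains `T r` with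
coefficient `n ω(t, r) ≠ 0`. -/
theorem mem_engel (hT : IsHamiltonianFamily ω T) (s r : G) : T r ∈ LieSubalgebra.engel ℂ (T s) := by
  classical
  rcases eq_or_ne s 0 with rfl | hs
  · rw [hT.apply_zero, LieSubalgebra.engel_zero]; trivial
  rcases eq_or_ne r 0 with rfl | hr
  · rw [hT.apply_zero]; exact zero_mem _
  let A : Module.End ℂ L := LieAlgebra.ad ℂ L (T s)
  let A' : Module.End ℂ L := LieAlgebra.ad ℂ L (T (s + s))
  have hAA' : Commute A A' := by
    rw [commute_iff_lie_eq, ← LieHom.map_lie, hT.lie, map_add, hT.alt, add_zero, zero_smul,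
      map_zero]
  have hfin := Module.End.finite_setOf_pencil A ((4 : ℂ) • A - A')
    (((Commute.refl A).smul_right _).sub_right hAA')
  set F := {c : ℂ | ∃ w, (∀ n, (A ^ n) w ≠ 0) ∧
    (2 : ℂ) • A (A w) + c • ((4 : ℂ) • A - A') w = 0} with hF
  have generic : ∀ r, ω s r ∉ F → T r ∈ LieSubalgebra.engel ℂ (T s) := by
    intro r hr
    by_contra hne
    rw [LieSubalgebra.mem_engel_iff] at hne
    push Not at hne
    refine hr ⟨⁅T s, T r⁆, fun n => ?_, hT.pencil_lie s r⟩
    have := hne (n + 1)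
    rwa [pow_succ, Module.End.mul_apply, LieAlgebra.ad_apply] at this
  obtain ⟨t, ht⟩ := hT.exists_forall_ne_zero {r, s} (by simp [hr, hs])
  have htr : ω t r ≠ 0 := ht r (by simp)
  have hst : ω s t ≠ 0 := by
    rw [hT.skew, neg_ne_zero]; exact ht s (by simp)
  -- The three excluded sets make `nt` generic, make `r - nt` generic, and keep `n ≠ 0`.
  obtain ⟨n, hn⟩ := Complex.exists_natCast_notMem (((hfin.image fun x => x / ω s t).union
    (hfin.image fun x => (ω s r - x) / ω s t)).union (Set.finite_singleton 0))
  simp only [Set.mem_union, Set.mem_singleton_iff, not_or, Set.mem_image, not_exists,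
    not_and] at hn
  obtain ⟨⟨hn1, hn2⟩, hn0⟩ := hn
  have hu : T (n • t) ∈ LieSubalgebra.engel ℂ (T s) := by
    refine generic _ fun hm => hn1 _ hm ?_
    rw [map_nsmul, nsmul_eq_mul]; field_simp
  have hv : T (r - n • t) ∈ LieSubalgebra.engel ℂ (T s) := by
    refine generic _ fun hm => hn2 _ hm ?_
    rw [map_sub, map_nsmul, nsmul_eq_mul]; field_simp; ring
  have hc : ω (n • t) (r - n • t) ≠ 0 := by
    rw [map_sub, hT.alt, sub_zero, map_nsmul, AddMonoidHom.nsmul_apply, nsmul_eq_mul]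
    exact mul_ne_zero hn0 htr
  have hb := hT.lie (n • t) (r - n • t)
  rw [add_sub_cancel] at hb
  have : T r = (ω (n • t) (r - n • t))⁻¹ • ⁅T (n • t), T (r - n • t)⁆ + T (n • t) +
      T (r - n • t) := by
    rw [hb, smul_smul, inv_mul_cancel₀ hc]; module
  rw [this]
  exact add_mem (add_mem (SMulMemClass.smul_mem _ (LieSubalgebra.lie_mem _ hu hv)) hu) hv

/-- The Engel subalgebra of `T s` contains the spanning family, so it is everything; generalized
null spaces stabilise by the dimension. -/
theorem ad_pow_eq_zero (hT : IsHamiltonianFamily ω T) (s : G) (m : ℕ)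
    (hm : Module.finrank ℂ L ≤ m) (y : L) : (LieAlgebra.ad ℂ L (T s) ^ m) y = 0 := by
  have h : (LieSubalgebra.engel ℂ (T s)).toSubmodule = ⊤ := by
    rw [eq_top_iff, ← hT.span, Submodule.span_le]
    rintro _ ⟨r, rfl⟩
    exact hT.mem_engel s r
  have hy : y ∈ (LieAlgebra.ad ℂ L (T s)).maxGenEigenspace 0 := by
    have : y ∈ (LieSubalgebra.engel ℂ (T s)).toSubmodule := h ▸ Submodule.mem_top
    exact this
  rw [Module.End.maxGenEigenspace_eq_genEigenspace_finrank, Module.End.mem_genEigenspace_nat,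
    zero_smul, sub_zero, LinearMap.mem_ker] at hy
  exact Module.End.pow_map_zero_of_le hm hy

end FiniteDimensional

/-! ### Finite differences and polynomiality along arithmetic progressions. -/

theorem lie_fwdDiff (hT : IsHamiltonianFamily ω T) (s : G) (j : ℕ) (r : G) :
    ⁅T s, (fwdDiff s)^[j + 1] T r⁆ = ω s r • (fwdDiff s)^[j + 2] T r := by
  induction j generalizing r with
  | zero =>
    simp only [zero_add, Function.iterate_succ, Function.iterate_zero, Function.comp_apply, id_eq,
      fwdDiff, lie_sub, hT.lie, map_add, hT.alt, add_comm s]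
    module
  | succ j ih =>
    rw [Function.iterate_succ_apply', Function.iterate_succ_apply' _ (j + 2), fwdDiff, fwdDiff,
      lie_sub, ih, ih, map_add, hT.alt, add_zero, smul_sub]

/-- When `ω(s, r) ≠ 0`, this converts nilpotency of `ad T(s)` into the vanishing of high finite
differences of `T` at `r`. -/
theorem ad_pow_fwdDiff (hT : IsHamiltonianFamily ω T) (s r : G) (m : ℕ) :
    (LieAlgebra.ad ℂ L (T s) ^ m) (fwdDiff s T r) = ω s r ^ m • (fwdDiff s)^[m + 1] T r := by
  induction m with
  | zero => simp
  | succ m ih =>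
    rw [pow_succ', Module.End.mul_apply, ih, _root_.map_smul, LieAlgebra.ad_apply, hT.lie_fwdDiff,
      smul_smul, pow_succ]

section FiniteDimensional

variable [FiniteDimensional ℂ L]

/-- Newton's series `∑ (n choose k) Δ_s^k T(r)` stops at `k = dim L`, and `n choose k` is a
polynomial in `n` of degree `k`. -/
theorem exists_eval_add_nsmul (hT : IsHamiltonianFamily ω T) (s r : G) (hsr : ω s r ≠ 0) :
    ∃ Q : PolynomialModule ℂ L, (∀ n : ℕ, T (r + n • s) = eval (n : ℂ) Q) ∧
      ∀ j, Module.finrank ℂ L < j → Q.coeff j = 0 := by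
  set d := Module.finrank ℂ L with hd
  have hzero : ∀ k, d + 1 ≤ k → (fwdDiff s)^[k] T r = 0 := by
    intro k hk
    obtain ⟨m, rfl⟩ : ∃ m, k = m + 1 := ⟨k - 1, by omega⟩
    have := hT.ad_pow_fwdDiff s r m
    rw [hT.ad_pow_eq_zero s m (by omega)] at this
    exact (smul_eq_zero.mp this.symm).resolve_left (pow_ne_zero _ hsr)
  refine ⟨∑ k ∈ Finset.range (d + 1),
    (Polynomial.C ((k.factorial : ℂ)⁻¹) * descPochhammer ℂ k) •
      single ℂ 0 ((fwdDiff s)^[k] T r), fun n => ?_, fun j hj => ?_⟩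
  · rw [shift_eq_sum_fwdDiff_iter s T n r, map_sum]
    have hterm : ∀ k, n.choose k • (fwdDiff s)^[k] T r = eval (n : ℂ)
        ((Polynomial.C ((k.factorial : ℂ)⁻¹) * descPochhammer ℂ k) •
          single ℂ 0 ((fwdDiff s)^[k] T r)) := by
      intro k
      rw [eval_smul, eval_single, pow_zero, one_smul, Polynomial.eval_mul, Polynomial.eval_C,
        ← div_eq_inv_mul, ← Nat.cast_choose_eq_descPochhammer_div, Nat.cast_smul_eq_nsmul]
    rw [← Finset.sum_congr rfl fun k _ => hterm k]
    -- Both sums are extended to a common range: beyond `n` the binomial coefficients vanish, beyond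
    -- `dim L` the differences do.
    rw [Finset.sum_subset (Finset.range_subset_range.mpr (le_max_left (n + 1) (d + 1))),
      Finset.sum_subset (Finset.range_subset_range.mpr (le_max_right (n + 1) (d + 1)))]
    · intro k _ hk
      rw [Finset.mem_range, not_lt] at hk
      rw [hzero k hk, smul_zero]
    · intro k _ hk
      rw [Finset.mem_range, not_lt] at hk
      rw [Nat.choose_eq_zero_of_lt hk, zero_smul]
  · rw [coeff_sum, Finsupp.finsetSum_apply]
    refine Finset.sum_eq_zero fun k hk => ?_
    rw [smul_single_apply, if_pos (Nat.zero_le _), Nat.sub_zero, Polynomial.coeff_C_mul,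
      Polynomial.coeff_eq_zero_of_natDegree_lt, mul_zero, zero_smul]
    rw [descPochhammer_natDegree]
    rw [Finset.mem_range] at hk
    omega

/-- The previous lemma needs a base point pairing non-trivially with `s`, which `0` does not. So
`T(ns)` is reached through the bracket of `T(r)` with `T(-r + ns)`, at the cost of a factor `n`. -/
theorem exists_eval_nsmul (hT : IsHamiltonianFamily ω T) (s : G) :
    ∃ P : PolynomialModule ℂ L, (∀ n : ℕ, 1 ≤ n → T (n • s) = eval (n : ℂ) P) ∧
      ∀ j, Module.finrank ℂ L + 1 ≤ j → P.coeff j = 0 := by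
  rcases eq_or_ne s 0 with rfl | hs
  · exact ⟨0, by simp [hT.apply_zero], by simp⟩
  obtain ⟨r, hr⟩ := hT.nondeg s hs
  obtain ⟨Q, hQ, hQd⟩ := hT.exists_eval_add_nsmul s (-r) (by
    rw [map_neg, neg_ne_zero, hT.skew, neg_ne_zero]; exact hr)
  have key : ∀ n : ℕ, (n : ℂ) • T (n • s) = (n : ℂ) • T r + (n : ℂ) • eval (n : ℂ) Q +
      (ω r s)⁻¹ • ⁅T r, eval (n : ℂ) Q⁆ := by
    intro n
    rw [← hQ, hT.lie, add_neg_cancel_left, map_add, map_neg, hT.alt, neg_zero, zero_add,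
      map_nsmul, nsmul_eq_mul, mul_comm, smul_smul, inv_mul_cancel_left₀ hr]
    module
  -- The factor `X` can be divided out because the constant term is a multiple of `[T r, T(-r)] =
  -- 0`.
  obtain ⟨P, hP, hPd⟩ := exists_X_smul_of_coeff_zero (Module.finrank ℂ L + 1)
    ((Polynomial.X : Polynomial ℂ) • single ℂ 0 (T r) + (Polynomial.X : Polynomial ℂ) • Q +
      (ω r s)⁻¹ • PolynomialModule.map ℂ (LieAlgebra.ad ℂ L (T r)) Q) (by
    have h0 := hQ 0
    rw [Nat.cast_zero, eval_zero_eq_coeff, zero_smul, add_zero] at h0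
    rw [coeff_add, coeff_add, Finsupp.add_apply, Finsupp.add_apply, coeff_X_smul_zero,
      coeff_X_smul_zero]
    change 0 + 0 + (ω r s)⁻¹ • (PolynomialModule.map ℂ (LieAlgebra.ad ℂ L (T r)) Q).coeff 0 = 0
    rw [coeff_map, ← h0, LieAlgebra.ad_apply, hT.lie, map_neg, hT.alt, neg_zero, zero_smul,
      smul_zero, add_zero, add_zero]) (by
    intro j hj
    obtain ⟨i, rfl⟩ : ∃ i, j = i + 1 := ⟨j - 1, by omega⟩
    rw [coeff_add, coeff_add, Finsupp.add_apply, Finsupp.add_apply, coeff_X_smul_succ,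
      coeff_X_smul_succ]
    change _ + _ + (ω r s)⁻¹ • (PolynomialModule.map ℂ (LieAlgebra.ad ℂ L (T r)) Q).coeff (i + 1)
      = 0
    rw [coeff_map, hQd i (by omega), hQd (i + 1) (by omega), map_zero, smul_zero, coeff_single,
      Finsupp.single_apply, if_neg (by omega), add_zero, add_zero])
  refine ⟨P, fun n hn => ?_, hPd⟩
  have h1 := congrArg (eval (n : ℂ)) hP
  rw [eval_X_smul, map_add, map_add, eval_X_smul, eval_X_smul, eval_single, _root_.map_smul,
    eval_map',
    pow_zero, one_smul, LieAlgebra.ad_apply, ← key] at h1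
  exact ((smul_right_injective _ (by exact_mod_cast (by omega : n ≠ 0))) h1).symm

end FiniteDimensional

/-! ### Bracket relations between the coefficients of `n ↦ T(ns)`. -/

section Coefficients

variable {P : G → PolynomialModule ℂ L}

/-- Both `P_{bs}(n)` and `P_s(bn)` compute `T(nbs)`. -/
theorem coeff_nsmul (hP : ∀ s, ∀ n : ℕ, 1 ≤ n → T (n • s) = eval (n : ℂ) (P s)) (s : G)
    (b : ℕ) (hb : 1 ≤ b) (j : ℕ) : (P (b • s)).coeff j = (b : ℂ) ^ j • (P s).coeff j := by
  rw [← coeff_comp_C_mul_X]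
  congr 2
  refine ext_eval_natCast fun n hn => ?_
  rw [comp_eval, ← hP _ _ hn, smul_smul, hP _ _ (one_le_mul hn hb)]
  simp [mul_comm]

/-- Coefficients of `n^{k+2}` in `[T(nr), T(ns)] = n² ω(r, s) (T(n(r+s)) - T(nr) - T(ns))`. -/
theorem sum_lie_coeff (hT : IsHamiltonianFamily ω T)
    (hP : ∀ s, ∀ n : ℕ, 1 ≤ n → T (n • s) = eval (n : ℂ) (P s)) (r s : G) (k : ℕ) :
    ∑ ij ∈ Finset.HasAntidiagonal.antidiagonal (k + 2), ⁅(P r).coeff ij.1, (P s).coeff ij.2⁆ =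
      ω r s • ((P (r + s)).coeff k - (P r).coeff k - (P s).coeff k) := by
  obtain ⟨z, hz, hzc⟩ := exists_lie (P r) (P s)
  have : z = (Polynomial.X : Polynomial ℂ) • (Polynomial.X : Polynomial ℂ) •
      (ω r s • (P (r + s) + (-1 : ℂ) • P r + (-1 : ℂ) • P s)) := by
    refine ext_eval_natCast fun n hn => ?_
    rw [hz, ← hP _ _ hn, ← hP _ _ hn, hT.lie, eval_X_smul, eval_X_smul,
      LinearMap.map_smul, LinearMap.map_add, LinearMap.map_add, LinearMap.map_smul,
      LinearMap.map_smul, ← hP _ _ hn, ← hP _ _ hn, ← hP _ _ hn, smul_add n r s]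
    simp only [map_nsmul, AddMonoidHom.nsmul_apply, nsmul_eq_mul]
    module
  rw [← hzc, this, coeff_X_smul_succ, coeff_X_smul_succ]
  change ω r s • ((P (r + s)).coeff k + (-1 : ℂ) • (P r).coeff k + (-1 : ℂ) • (P s).coeff k) = _
  module

/-- Replacing `s` by `bs` multiplies the `(i, j)` term of the preceding sum by `b^j`. The sum is
then a polynomial in `b` with values in the span for all `b ≥ 1`, so each term lies there
separately. -/
theorem lie_coeff_mem (hT : IsHamiltonianFamily ω T)
    (hP : ∀ s, ∀ n : ℕ, 1 ≤ n → T (n • s) = eval (n : ℂ) (P s)) (r s : G) (i j k : ℕ)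
    (hij : i + j = k + 2) :
    ⁅(P r).coeff i, (P s).coeff j⁆ ∈ Submodule.span ℂ (Set.range fun r => (P r).coeff k) := by
  set S := Submodule.span ℂ (Set.range fun r => (P r).coeff k)
  have hS : ∀ r, (P r).coeff k ∈ S := fun r => Submodule.subset_span ⟨r, rfl⟩
  have := coeff_mem_of_eval_mem S (∑ ij ∈ Finset.HasAntidiagonal.antidiagonal (k + 2),
    single ℂ ij.2 ⁅(P r).coeff ij.1, (P s).coeff ij.2⁆) (fun b hb => by
      rw [map_sum]
      have h : ∀ ij : ℕ × ℕ, eval (b : ℂ) (single ℂ ij.2 ⁅(P r).coeff ij.1, (P s).coeff ij.2⁆) =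
          ⁅(P r).coeff ij.1, (P (b • s)).coeff ij.2⁆ := fun ij => by
        rw [eval_single, coeff_nsmul hP s b hb, lie_smul]
      rw [Finset.sum_congr rfl fun ij _ => h ij, hT.sum_lie_coeff hP]
      exact S.smul_mem _ (S.sub_mem (S.sub_mem (hS _) (hS _)) (hS _))) j
  rw [coeff_sum, Finsupp.finsetSum_apply, Finset.sum_eq_single (i, j)] at this
  · simpa using this
  · rintro ⟨a, b⟩ hab hne
    rw [Finset.HasAntidiagonal.mem_antidiagonal] at hab
    rw [coeff_single, Finsupp.single_apply, if_neg]
    rintro rfl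
    exact hne (by simp only [Prod.mk.injEq, and_true]; simp only at hab; omega)
  · intro h
    exact absurd (Finset.HasAntidiagonal.mem_antidiagonal.mpr hij) h

end Coefficients

/-! ### Trivial radical forces `T` to be quadratic. -/

section TrivialRadical

theorem eq_zero_of_forall_lie [LieAlgebra.HasTrivialRadical ℂ L] (hT : IsHamiltonianFamily ω T)
    (z : L) (hz : ∀ r, ⁅T r, z⁆ = 0) :
    z = 0 := by
  have h : z ∈ LieAlgebra.center ℂ L := by
    rw [LieModule.mem_maxTrivSubmodule]
    intro x
    have hx : x ∈ Submodule.span ℂ (Set.range T) := hT.span ▸ Submodule.mem_top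
    induction hx using Submodule.span_induction with
    | mem x hx => obtain ⟨r, rfl⟩ := hx; exact hz r
    | zero => exact zero_lie _
    | add x y _ _ hx hy => rw [add_lie, hx, hy, add_zero]
    | smul c x _ hx => rw [smul_lie, hx, smul_zero]
  rw [LieAlgebra.center_eq_bot] at h
  exact h

variable [FiniteDimensional ℂ L] {P : G → PolynomialModule ℂ L}

/-- `[T r, T(ns)] = n ω(r, s) (T(r+ns) - T r - T(ns))` is divisible by `n`, and in the second factor
`T(r+ns) - T r` has no constant term. Hence the `c_0` are central, and once they vanish so are the
`c_1`. -/
theorem lie_coeff_zero_one (hT : IsHamiltonianFamily ω T)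
    (hP : ∀ s, ∀ n : ℕ, 1 ≤ n → T (n • s) = eval (n : ℂ) (P s)) (r s : G) :
    ⁅T r, (P s).coeff 0⁆ = 0 ∧ ⁅T r, (P s).coeff 1⁆ = -(ω r s • (P s).coeff 0) := by
  have hc := fun j => coeff_map (LieAlgebra.ad ℂ L (T r)) (P s) j
  simp only [LieAlgebra.ad_apply] at hc
  rw [← hc 0, ← hc 1]
  -- If `ω(r, s) = 0`, then `T(r + ns)` is not known to be polynomial, but the bracket vanishes
  -- identically.
  by_cases hrs : ω r s = 0
  · have : PolynomialModule.map ℂ (LieAlgebra.ad ℂ L (T r)) (P s) = 0 := by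
      refine eq_zero_of_eval_natCast_eq_zero _ fun n hn => ?_
      rw [eval_map', ← hP s n hn, LieAlgebra.ad_apply, hT.lie, map_nsmul, hrs, smul_zero, zero_smul]
    rw [this, hrs, coeff_zero, zero_smul, neg_zero]
    exact ⟨rfl, rfl⟩
  · obtain ⟨Q, hQ, -⟩ := hT.exists_eval_add_nsmul s r (by rw [hT.skew, neg_ne_zero]; exact hrs)
    have h0 := hQ 0
    rw [Nat.cast_zero, eval_zero_eq_coeff, zero_smul, add_zero] at h0
    have : PolynomialModule.map ℂ (LieAlgebra.ad ℂ L (T r)) (P s) = (Polynomial.X : Polynomial ℂ) •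
        (ω r s • (Q + (-1 : ℂ) • single ℂ 0 (T r) + (-1 : ℂ) • P s)) := by
      refine ext_eval_natCast fun n hn => ?_
      rw [eval_map', ← hP s n hn, LieAlgebra.ad_apply, hT.lie, eval_X_smul,
        LinearMap.map_smul, LinearMap.map_add, LinearMap.map_add, LinearMap.map_smul,
        LinearMap.map_smul, ← hP s n hn, ← hQ, eval_single, map_nsmul, nsmul_eq_mul]
      module
    rw [this]
    refine ⟨coeff_X_smul_zero _, ?_⟩
    rw [coeff_X_smul_succ]
    change ω r s • (Q.coeff 0 + (-1 : ℂ) • (single ℂ 0 (T r)).coeff 0 +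
      (-1 : ℂ) • (P s).coeff 0) = _
    rw [← h0, coeff_single, Finsupp.single_apply, if_pos rfl]
    module

variable [LieAlgebra.HasTrivialRadical ℂ L]

theorem coeff_zero_one_eq_zero (hT : IsHamiltonianFamily ω T)
    (hP : ∀ s, ∀ n : ℕ, 1 ≤ n → T (n • s) = eval (n : ℂ) (P s)) (s : G) :
    (P s).coeff 0 = 0 ∧ (P s).coeff 1 = 0 := by
  have h0 : (P s).coeff 0 = 0 :=
    hT.eq_zero_of_forall_lie _ fun r => (hT.lie_coeff_zero_one hP r s).1
  refine ⟨h0, hT.eq_zero_of_forall_lie _ fun r => ?_⟩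
  rw [(hT.lie_coeff_zero_one hP r s).2, h0, smul_zero, neg_zero]

/-- Bracketing with `c_i` sends the span of the top coefficients `c_k` to degree `i + k - 2`: it is
preserved for `i = 2`, killed for `i > 2`, and `c_0 = c_1 = 0`. So the span is an ideal; it is
abelian since `2k - 2 > k` for `k ≥ 3`, hence zero. -/
theorem coeff_eq_zero_of_forall_gt (hT : IsHamiltonianFamily ω T)
    (hP : ∀ s, ∀ n : ℕ, 1 ≤ n → T (n • s) = eval (n : ℂ) (P s)) (k : ℕ) (hk : 3 ≤ k)
    (h : ∀ j, k < j → ∀ s, (P s).coeff j = 0) (s : G) : (P s).coeff k = 0 := by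
  set S := Submodule.span ℂ (Set.range fun r => (P r).coeff k) with hS
  have hmem : ∀ r s i, ⁅(P r).coeff i, (P s).coeff k⁆ ∈ S := by
    intro r s i
    rcases lt_trichotomy i 2 with hi | rfl | hi
    · have : (P r).coeff i = 0 := by
        interval_cases i
        · exact (hT.coeff_zero_one_eq_zero hP r).1
        · exact (hT.coeff_zero_one_eq_zero hP r).2
      rw [this, zero_lie]; exact S.zero_mem
    · exact hT.lie_coeff_mem hP r s 2 k k (by omega)
    · have := hT.lie_coeff_mem hP r s i k (i + k - 2) (by omega)
      have hz : Submodule.span ℂ (Set.range fun r => (P r).coeff (i + k - 2)) = ⊥ := by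
        rw [Submodule.span_eq_bot]
        rintro _ ⟨r, rfl⟩
        exact h _ (by omega) r
      rw [hz, Submodule.mem_bot] at this
      rw [this]; exact S.zero_mem
  have hz : ∀ r s, ⁅(P r).coeff k, (P s).coeff k⁆ = 0 := by
    intro r s
    have := hT.lie_coeff_mem hP r s k k (k + k - 2) (by omega)
    have hz : Submodule.span ℂ (Set.range fun r => (P r).coeff (k + k - 2)) = ⊥ := by
      rw [Submodule.span_eq_bot]
      rintro _ ⟨r, rfl⟩
      exact h _ (by omega) r
    rwa [hz, Submodule.mem_bot] at this
  let I : LieIdeal ℂ L :=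
    { S with
      lie_mem := by
        intro x y hy
        change y ∈ S at hy
        change ⁅x, y⁆ ∈ S
        have hx : x ∈ Submodule.span ℂ (Set.range T) := hT.span ▸ Submodule.mem_top
        induction hy using Submodule.span_induction with
        | mem y hy =>
          obtain ⟨s, rfl⟩ := hy
          induction hx using Submodule.span_induction with
          | mem x hx =>
            obtain ⟨r, rfl⟩ := hx
            have h1 := hP r 1 le_rfl
            rw [one_smul] at h1
            rw [h1, ← lie_skew, ← LieAlgebra.ad_apply (R := ℂ), ← eval_map']
            refine S.neg_mem (eval_mem_of_coeff_mem _ _ (fun j => ?_) _)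
            rw [coeff_map, LieAlgebra.ad_apply, ← lie_skew]
            exact S.neg_mem (hmem r s j)
          | zero => rw [zero_lie]; exact S.zero_mem
          | add x y _ _ hx hy => rw [add_lie]; exact S.add_mem hx hy
          | smul c x _ hx => rw [smul_lie]; exact S.smul_mem _ hx
        | zero => rw [lie_zero]; exact S.zero_mem
        | add x y _ _ hx hy => rw [lie_add]; exact S.add_mem hx hy
        | smul c x _ hx => rw [lie_smul]; exact S.smul_mem _ hx }
  have hab : IsLieAbelian I := by
    refine ⟨fun x y => Subtype.ext ?_⟩
    have := JetModule.span_lie_mem (P := (⊥ : Submodule ℂ L))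
      (S := Set.range fun r => (P r).coeff k) (by
        rintro _ ⟨r, rfl⟩ _ ⟨s, rfl⟩
        exact hz r s) (x := x) (y := y) x.2 y.2
    exact this
  have hI : I = ⊥ := (LieAlgebra.hasTrivialRadical_iff_no_abelian_ideals ℂ L).mp inferInstance I hab
  have : (P s).coeff k ∈ I := Submodule.subset_span ⟨s, rfl⟩
  rw [hI] at this
  exact this

/-- Descending induction from the degree bound `dim L` leaves only the coefficient of `n²`. -/
theorem map_nsmul_eq (hT : IsHamiltonianFamily ω T) (s : G) (n : ℕ) (hn : 1 ≤ n) :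
    T (n • s) = (n : ℂ) ^ 2 • T s := by
  choose P hP hPd using hT.exists_eval_nsmul
  have hall : ∀ m k, 3 ≤ k → Module.finrank ℂ L + 1 ≤ k + m → ∀ s, (P s).coeff k = 0 := by
    intro m
    induction m with
    | zero => exact fun k _ hk s => hPd s k hk
    | succ m ih =>
      intro k hk hkm
      exact hT.coeff_eq_zero_of_forall_gt hP k hk fun j hj s => ih j (by omega) (by omega) s
  have h2 : P s = single ℂ 2 ((P s).coeff 2) := by
    ext j
    rw [coeff_single, Finsupp.single_apply]
    split_ifs with h
    · rw [h]
    · rcases lt_or_ge j 2 with hj | hj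
      · interval_cases j
        · exact (hT.coeff_zero_one_eq_zero hP s).1
        · exact (hT.coeff_zero_one_eq_zero hP s).2
      · exact hall (Module.finrank ℂ L + 1) j (by omega) (by omega) s
  have h1 := hP s 1 le_rfl
  rw [hP s n hn]
  rw [one_smul] at h1
  rw [h1, h2, eval_single, eval_single, Nat.cast_one, one_pow, one_smul]

/-- Expand `[T(r-s), T(2s)] = 4 [T(r-s), T(s)]` by the defining relation on both sides and cancel
`ω(r, s)`. -/
theorem parallelogram_of_ne_zero (hT : IsHamiltonianFamily ω T) (r s : G) (hrs : ω r s ≠ 0) :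
    T (r + s) + T (r - s) = (2 : ℂ) • T r + (2 : ℂ) • T s := by
  have e : ω (r - s) s = ω r s := by
    rw [map_sub, AddMonoidHom.sub_apply, hT.alt, sub_zero]
  have h1 := hT.lie (r - s) s
  have h2 := hT.lie (r - s) (2 • s)
  rw [hT.map_nsmul_eq s 2 (by norm_num), lie_smul, h1, two_smul ℕ s, ← add_assoc, sub_add_cancel,
    map_add, e, ← two_mul, mul_comm (2 : ℂ) (ω r s), mul_smul, smul_comm _ (ω r s)] at h2
  have h3 := smul_right_injective L hrs h2
  push_cast at h3
  have h4 := smul_right_injective L (two_ne_zero (α := ℂ)) (a₁ := T (r + s) + T (r - s))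
    (a₂ := (2 : ℂ) • T r + (2 : ℂ) • T s) (by
      simp only
      rw [← sub_eq_zero] at h3 ⊢
      rw [← neg_eq_zero, ← h3]
      module)
  exact h4

theorem map_neg_eq (hT : IsHamiltonianFamily ω T) (s : G) : T (-s) = T s := by
  rcases eq_or_ne s 0 with rfl | hs
  · rw [neg_zero]
  obtain ⟨r, hr⟩ := hT.nondeg s hs
  have h1 := hT.parallelogram_of_ne_zero r s hr
  have h2 := hT.parallelogram_of_ne_zero r (-s) (by rwa [map_neg, neg_ne_zero])
  rw [sub_neg_eq_add, ← sub_eq_add_neg, add_comm, h1, add_right_inj] at h2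
  exact (smul_right_injective L (two_ne_zero (α := ℂ)) h2).symm

/-- A Hamiltonian family in a finite-dimensional Lie algebra with trivial radical satisfies the
parallelogram law. -/
theorem parallelogram (hT : IsHamiltonianFamily ω T) (x y : G) :
    T (x + y) + T (x - y) = (2 : ℂ) • T x + (2 : ℂ) • T y := by
  classical
  by_cases hxy : ω x y = 0
  swap
  · exact hT.parallelogram_of_ne_zero x y hxy
  rcases eq_or_ne x 0 with rfl | hx
  · rw [zero_add, zero_sub, hT.map_neg_eq, hT.apply_zero]; module
  rcases eq_or_ne y 0 with rfl | hy
  · rw [add_zero, sub_zero, hT.apply_zero]; module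
  have h2 : ∀ z, T (z + z) = (4 : ℂ) • T z := fun z => by
    rw [← two_nsmul, hT.map_nsmul_eq z 2 (by norm_num)]; norm_num
  rcases eq_or_ne (x + y) 0 with h | hadd
  · obtain rfl : x = -y := eq_neg_of_add_eq_zero_left h
    rw [h, ← neg_add', hT.map_neg_eq, hT.map_neg_eq, h2, hT.apply_zero]; module
  rcases eq_or_ne (x - y) 0 with h | hsub
  · obtain rfl : x = y := sub_eq_zero.mp h
    rw [h, h2, hT.apply_zero]; module
  -- For orthogonal `x, y`, shift by a generic `t`: the law holds for `(x ± t, y)`, `(x ± y, t)` and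
  -- `(x, t)`, and these five instances combine to the one for `(x, y)`.
  obtain ⟨t, ht⟩ := hT.exists_forall_ne_zero {x, y, x + y, x - y} (by simp [hx, hy, hadd, hsub])
  have e1 := hT.parallelogram_of_ne_zero (x + t) y (by
    rw [map_add, AddMonoidHom.add_apply, hxy, zero_add]; exact ht y (by simp))
  have e2 := hT.parallelogram_of_ne_zero (x - t) y (by
    rw [map_sub, AddMonoidHom.sub_apply, hxy, zero_sub, neg_ne_zero]; exact ht y (by simp))
  have e3 := hT.parallelogram_of_ne_zero (x + y) t (by
    rw [hT.skew, neg_ne_zero]; exact ht _ (by simp))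
  have e4 := hT.parallelogram_of_ne_zero (x - y) t (by
    rw [hT.skew, neg_ne_zero]; exact ht _ (by simp))
  have e5 := hT.parallelogram_of_ne_zero x t (by
    rw [hT.skew, neg_ne_zero]; exact ht _ (by simp))
  rw [show x + t + y = x + y + t by abel, show x + t - y = x - y + t by abel] at e1
  rw [show x - t + y = x + y - t by abel, show x - t - y = x - y - t by abel] at e2
  refine smul_right_injective L (two_ne_zero (α := ℂ)) ?_
  simp only
  linear_combination (norm := module) e1 + e2 - e3 - e4 + (2 : ℂ) • e5

end TrivialRadical

end IsHamiltonianFamily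

/-! ### Maps on `ℤ^ι` satisfying the parallelogram law. -/

section Parallelogram

variable {G M : Type*} [AddCommGroup G] [AddCommGroup M] [Module ℂ M] {q : G → M}

theorem map_add_add_of_parallelogram
    (hq : ∀ x y, q (x + y) + q (x - y) = (2 : ℂ) • q x + (2 : ℂ) • q y) (x y z : G) :
    q (x + y + z) + q x + q y + q z = q (x + y) + q (x + z) + q (y + z) := by
  have e1 := hq (x + y) z
  have e2 := hq x (y - z)
  have e3 := hq (x + z) y
  have e4 := hq y z
  rw [show x + (y - z) = x + y - z by abel, show x - (y - z) = x + z - y by abel] at e2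
  rw [show x + z + y = x + y + z by abel] at e3
  refine smul_right_injective M (two_ne_zero (α := ℂ)) ?_
  simp only
  linear_combination (norm := module) e1 - e2 + e3 - (2 : ℂ) • e4

/-- The polar form `b` is biadditive with `2 q(x) = b(x, x)`, so `q(r)` is a fixed linear expression
in the products `r_i r_j`. -/
theorem sum_smul_eq_zero_of_parallelogram {ι : Type*} [Fintype ι] {q : (ι → ℤ) → M}
    (hq : ∀ x y, q (x + y) + q (x - y) = (2 : ℂ) • q x + (2 : ℂ) • q y)
    (a : (ι → ℤ) →₀ ℂ) (ha : ∀ i j, (a.sum fun r c => c * ((r i : ℂ) * (r j : ℂ))) = 0) :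
    (a.sum fun r c => c • q r) = 0 := by
  classical
  have h0 : q 0 = 0 := by
    have := hq 0 0
    rw [add_zero, sub_zero] at this
    refine smul_right_injective M (two_ne_zero (α := ℂ)) ?_
    simp only
    linear_combination (norm := module) -this
  let b : (ι → ℤ) →+ (ι → ℤ) →+ M :=
    AddMonoidHom.mk' (fun x => AddMonoidHom.mk' (fun y => q (x + y) - q x - q y) (by
      intro y z
      have := map_add_add_of_parallelogram hq x y z
      rw [add_assoc x y z] at this
      linear_combination (norm := module) this)) (by
      intro x y
      refine AddMonoidHom.ext fun z => ?_
      have := map_add_add_of_parallelogram hq x y z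
      change q (x + y + z) - q (x + y) - q z =
        (q (x + z) - q x - q z) + (q (y + z) - q y - q z)
      linear_combination (norm := module) this)
  have hb : ∀ x, (2 : ℂ) • q x = b x x := by
    intro x
    have h1 := hq x x
    rw [sub_self, h0] at h1
    change _ = q (x + x) - q x - q x
    linear_combination (norm := module) -h1
  have hbe : ∀ x : ι → ℤ, b x x =
      ∑ i, ∑ j, ((x i : ℂ) * (x j : ℂ)) • b (Pi.single i 1) (Pi.single j 1) := by
    intro x
    have hx : x = ∑ i, x i • Pi.single i (1 : ℤ) := by
      conv_lhs => rw [pi_eq_sum_univ' x]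
    conv_lhs => rw [hx]
    simp only [map_sum, map_zsmul, AddMonoidHom.finsetSum_apply, AddMonoidHom.zsmul_apply,
      mul_smul, Int.cast_smul_eq_zsmul]
    simp only [Finset.smul_sum]
    rw [Finset.sum_comm]
    exact Finset.sum_congr rfl fun i _ => Finset.sum_congr rfl fun j _ => smul_comm _ _ _
  refine smul_right_injective M (two_ne_zero (α := ℂ)) ?_
  simp only [Finsupp.sum, Finset.smul_sum, smul_zero]
  have : ∀ r ∈ a.support, (2 : ℂ) • a r • q r = ∑ i, ∑ j,
      (a r * ((r i : ℂ) * (r j : ℂ))) • b (Pi.single i 1) (Pi.single j 1) := by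
    intro r _
    rw [smul_comm, hb, hbe]
    simp only [Finset.smul_sum, mul_smul]
  rw [Finset.sum_congr rfl this, Finset.sum_comm]
  refine Finset.sum_eq_zero fun i _ => ?_
  rw [Finset.sum_comm]
  refine Finset.sum_eq_zero fun j _ => ?_
  rw [← Finset.sum_smul]
  have := ha i j
  rw [Finsupp.sum] at this
  rw [this, zero_smul]

end Parallelogram

/-! ### Factoring, irreducibility transfer and the trace-free part of a representation. -/

section LieHelpers

theorem LieHom.exists_factor {L L' E : Type*} [LieRing L] [LieAlgebra ℂ L] [LieRing L']
    [LieAlgebra ℂ L'] [LieRing E] [LieAlgebra ℂ E] (ψ : L →ₗ⁅ℂ⁆ L')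
    (hψ : Function.Surjective ψ) (ρ : L →ₗ⁅ℂ⁆ E) (h : ∀ x, ψ x = 0 → ρ x = 0) :
    ∃ f : L' →ₗ⁅ℂ⁆ E, ∀ x, f (ψ x) = ρ x := by
  have key : ∀ x, ρ (Function.surjInv hψ (ψ x)) = ρ x := by
    intro x
    rw [← sub_eq_zero, ← map_sub]
    apply h
    rw [map_sub, Function.surjInv_eq hψ, sub_self]
  refine ⟨{ toFun := fun y => ρ (Function.surjInv hψ y), map_add' := ?_, map_smul' := ?_,
            map_lie' := ?_ }, key⟩
  · intro x y
    obtain ⟨x, rfl⟩ := hψ x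
    obtain ⟨y, rfl⟩ := hψ y
    rw [← map_add, key, key, key, map_add]
  · intro c x
    obtain ⟨x, rfl⟩ := hψ x
    rw [← map_smul, key, key, map_smul, RingHom.id_apply]
  · intro x y
    obtain ⟨x, rfl⟩ := hψ x
    obtain ⟨y, rfl⟩ := hψ y
    rw [← LieHom.map_lie, key, key, key, LieHom.map_lie]

/-- Twisting by scalars or changing the acting algebra leaves the stable subspaces alone;
irreducibility is moved between `T`, its trace-free image and `sp_{2m}` this way. -/
theorem LieModule.isIrreducible_of_stable {L L' V : Type*} [LieRing L] [LieAlgebra ℂ L]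
    [LieRing L'] [LieAlgebra ℂ L'] [AddCommGroup V] [Module ℂ V] [LieRingModule L V]
    [LieModule ℂ L V] [LieRingModule L' V] [LieModule ℂ L' V] (h : LieModule.IsIrreducible ℂ L V)
    (H : ∀ W : Submodule ℂ V, (∀ (x : L') (v : V), v ∈ W → ⁅x, v⁆ ∈ W) →
      ∀ (x : L) (v : V), v ∈ W → ⁅x, v⁆ ∈ W) : LieModule.IsIrreducible ℂ L' V := by
  have : Nontrivial V := LieModule.nontrivial_of_isIrreducible ℂ L V
  refine LieModule.IsIrreducible.mk fun W hW => ?_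
  let W' : LieSubmodule ℂ L V :=
    { W.toSubmodule with
      lie_mem := fun {x v} hv => H W.toSubmodule (fun x v hv => W.lie_mem hv) x v hv }
  rcases h.eq_bot_or_eq_top W' with h | h
  · refine absurd ?_ hW
    rw [← LieSubmodule.toSubmodule_eq_bot] at h ⊢
    exact h
  · rw [← LieSubmodule.toSubmodule_eq_top] at h ⊢
    exact h

/-- The trace-free part of a representation. -/
noncomputable def LieModule.traceFree (L V : Type*) [LieRing L] [LieAlgebra ℂ L] [AddCommGroup V]
    [Module ℂ V] [LieRingModule L V] [LieModule ℂ L V] :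
    L →ₗ⁅ℂ⁆ Module.End ℂ V where
  toFun x := toEnd ℂ L V x -
    ((Module.finrank ℂ V : ℂ)⁻¹ * LinearMap.trace ℂ V (toEnd ℂ L V x)) • 1
  map_add' x y := by rw [map_add, map_add, mul_add, add_smul]; abel
  map_smul' c x := by
    rw [map_smul, map_smul, smul_eq_mul, RingHom.id_apply, smul_sub, smul_smul]
    congr 2; ring
  map_lie' {x y} := by
    rw [LieHom.map_lie, LieRing.of_associative_ring_bracket, map_sub,
      LinearMap.trace_mul_comm ℂ (toEnd ℂ L V x), sub_self, mul_zero, zero_smul, sub_zero,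
      LieRing.of_associative_ring_bracket]
    simp only [sub_mul, mul_sub, smul_mul_assoc, mul_smul_comm, one_mul, mul_one]
    module

/-- The scalar part of a representation, the normalized trace. -/
noncomputable def LieModule.normTrace (L V : Type*) [LieRing L] [LieAlgebra ℂ L] [AddCommGroup V]
    [Module ℂ V] [LieRingModule L V] [LieModule ℂ L V] :
    L →ₗ⁅ℂ⁆ ℂ where
  toFun x := (Module.finrank ℂ V : ℂ)⁻¹ * LinearMap.trace ℂ V (toEnd ℂ L V x)
  map_add' x y := by rw [map_add, map_add, mul_add]
  map_smul' c x := by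
    rw [map_smul, map_smul, smul_eq_mul, RingHom.id_apply, smul_eq_mul]; ring
  map_lie' {x y} := by
    rw [LieHom.map_lie, LieRing.of_associative_ring_bracket, map_sub,
      LinearMap.trace_mul_comm ℂ (toEnd ℂ L V x), sub_self, mul_zero,
      LieRing.of_associative_ring_bracket, mul_comm, sub_self]

theorem LieModule.lie_eq_traceFree_add {L V : Type*} [LieRing L] [LieAlgebra ℂ L] [AddCommGroup V]
    [Module ℂ V] [LieRingModule L V] [LieModule ℂ L V] (x : L) (v : V) :
    ⁅x, v⁆ = traceFree L V x v + normTrace L V x • v := by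
  change _ = (toEnd ℂ L V x - _ • (1 : Module.End ℂ V)) v +
    ((Module.finrank ℂ V : ℂ)⁻¹ * LinearMap.trace ℂ V (toEnd ℂ L V x)) • v
  rw [LinearMap.sub_apply, toEnd_apply_apply]
  exact (sub_add_cancel ⁅x, v⁆ _).symm

variable {L V : Type*} [LieRing L] [LieAlgebra ℂ L] [AddCommGroup V] [Module ℂ V]
  [FiniteDimensional ℂ V] [LieRingModule L V] [LieModule ℂ L V]

theorem LieModule.trace_traceFree (h : LieModule.IsIrreducible ℂ L V) (x : L) :
    LinearMap.trace ℂ V (traceFree L V x) = 0 := by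
  have : Nontrivial V := LieModule.nontrivial_of_isIrreducible ℂ L V
  have h0 : (Module.finrank ℂ V : ℂ) ≠ 0 := by
    exact_mod_cast (Module.finrank_pos (R := ℂ) (M := V)).ne'
  change LinearMap.trace ℂ V (toEnd ℂ L V x - _ • 1) = 0
  rw [map_sub, map_smul, LinearMap.trace_one, smul_eq_mul, mul_right_comm, inv_mul_cancel₀ h0,
    one_mul, sub_self]

/-- The image of the trace-free part of a finite-dimensional irreducible representation has
trivial radical. -/
theorem LieModule.hasTrivialRadical_range_traceFree (h : LieModule.IsIrreducible ℂ L V) :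
    LieAlgebra.HasTrivialRadical ℂ (traceFree L V).range := by
  have hirr : LieModule.IsIrreducible ℂ (traceFree L V).range V := by
    refine LieModule.isIrreducible_of_stable h fun W hW x v hv => ?_
    rw [lie_eq_traceFree_add]
    exact W.add_mem (hW ⟨traceFree L V x, ⟨x, rfl⟩⟩ v hv) (W.smul_mem _ hv)
  -- The range acts faithfully, being a subalgebra of `End V`, and irreducibly; tracelessness
  -- excludes the remaining obstruction, non-zero scalars.
  refine LieAlgebra.hasTrivialRadical_of_isIrreducible_of_isFaithful ℂ _ V ?_
  rintro ⟨_, x, rfl⟩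
  exact trace_traceFree h x

end LieHelpers

/-! ### Consequences for irreducible modules, and twisted pullbacks. -/

section Generic

theorem LinearMap.map_finsupp_sum_smul {G L M : Type*} [AddCommGroup L] [Module ℂ L]
    [AddCommGroup M] [Module ℂ M] (f : L →ₗ[ℂ] M) (a : G →₀ ℂ) (T : G → L) :
    f (a.sum fun r c => c • T r) = a.sum fun r c => c • f (T r) := by
  simp [Finsupp.sum]

theorem IsHamiltonianFamily.map {G L L' : Type*} [AddCommGroup G] [LieRing L] [LieAlgebra ℂ L]
    [LieRing L'] [LieAlgebra ℂ L'] {ω : G →+ G →+ ℂ} {T : G → L} (hT : IsHamiltonianFamily ω T)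
    (f : L →ₗ⁅ℂ⁆ L') (hf : Function.Surjective f) : IsHamiltonianFamily ω fun r => f (T r) where
  alt := hT.alt
  nondeg := hT.nondeg
  apply_zero := by rw [hT.apply_zero, _root_.map_zero]
  lie r s := by rw [← LieHom.map_lie, hT.lie, map_smul, map_sub, map_sub]
  span := by
    have h : (Submodule.span ℂ (Set.range T)).map (f : L →ₗ[ℂ] L') = ⊤ := by
      rw [hT.span, Submodule.map_top, LinearMap.range_eq_top]
      exact hf
    rw [Submodule.map_span, ← Set.range_comp] at h
    exact h

/-- In a finite-dimensional irreducible module over a Lie algebra with a Hamiltonian family `T`,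
a combination of the `T r` with vanishing second moments acts by a scalar. -/
theorem IsHamiltonianFamily.traceFree_eq_zero {ι L V : Type*} [Fintype ι] [LieRing L]
    [LieAlgebra ℂ L] [AddCommGroup V] [Module ℂ V] [FiniteDimensional ℂ V] [LieRingModule L V]
    [LieModule ℂ L V] {ω : (ι → ℤ) →+ (ι → ℤ) →+ ℂ} {T : (ι → ℤ) → L}
    (hT : IsHamiltonianFamily ω T) (hV : LieModule.IsIrreducible ℂ L V) (a : (ι → ℤ) →₀ ℂ)
    (ha : ∀ i j, (a.sum fun r c => c * ((r i : ℂ) * (r j : ℂ))) = 0) :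
    LieModule.traceFree L V (a.sum fun r c => c • T r) = 0 := by
  have := LieModule.hasTrivialRadical_range_traceFree hV
  -- After corestriction to the range, the images of the `T r` form a Hamiltonian family in a
  -- finite-dimensional algebra with trivial radical.
  have hT' := hT.map (LieModule.traceFree L V).rangeRestrict (LieHom.surjective_rangeRestrict _)
  have hq := sum_smul_eq_zero_of_parallelogram
    (q := fun r => (LieModule.traceFree L V).rangeRestrict (T r)) hT'.parallelogram a ha
  have h2 := LinearMap.map_finsupp_sum_smul
    ((LieModule.traceFree L V).rangeRestrict : L →ₗ[ℂ] (LieModule.traceFree L V).range) a T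
  exact congrArg Subtype.val (h2.trans hq)

/-- The pullback of an irreducible module along a surjection, twisted by a character, is
irreducible. -/
theorem LieModule.exists_twisted_pullback {L K W : Type*} [LieRing L] [LieAlgebra ℂ L] [LieRing K]
    [LieAlgebra ℂ K] [AddCommGroup W] [Module ℂ W] [LieRingModule K W] [LieModule ℂ K W]
    (φ : L →ₗ⁅ℂ⁆ K) (hφ : Function.Surjective φ) (hW : LieModule.IsIrreducible ℂ K W)
    (χ : L →ₗ⁅ℂ⁆ ℂ) :
    ∃ (_ : LieRingModule L W) (_ : LieModule ℂ L W),
      LieModule.IsIrreducible ℂ L W ∧ ∀ (x : L) (v : W), ⁅x, v⁆ = ⁅φ x, v⁆ + χ x • v := by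
  let i1 : LieRingModule L W :=
    { bracket := fun x v => ⁅φ x, v⁆ + χ x • v
      add_lie := fun x y v => by
        rw [map_add, map_add, add_lie, add_smul]; abel
      lie_add := fun x v w => by
        rw [lie_add, smul_add]; abel
      leibniz_lie := fun x y v => by
        change ⁅φ x, ⁅φ y, v⁆ + χ y • v⁆ + χ x • (⁅φ y, v⁆ + χ y • v) =
          (⁅φ ⁅x, y⁆, v⁆ + χ ⁅x, y⁆ • v) +
            (⁅φ y, ⁅φ x, v⁆ + χ x • v⁆ + χ y • (⁅φ x, v⁆ + χ x • v))
        -- The character drops out of the bracket term because `ℂ` is commutative.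
        rw [LieHom.map_lie, LieHom.map_lie, LieRing.of_associative_ring_bracket,
          mul_comm (χ y), sub_self, zero_smul, add_zero, lie_add, lie_add, lie_smul, lie_smul,
          leibniz_lie]
        module }
  have hact : ∀ (x : L) (v : W), ⁅x, v⁆ = ⁅φ x, v⁆ + χ x • v := fun _ _ => rfl
  have i2 : LieModule ℂ L W :=
    { smul_lie := fun c x v => by
        rw [hact, hact, map_smul, map_smul, smul_lie, smul_add, smul_assoc]
      lie_smul := fun c x v => by
        rw [hact, hact, lie_smul, smul_add, smul_comm] }
  refine ⟨i1, i2, LieModule.isIrreducible_of_stable hW fun S hS x v hv => ?_, hact⟩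
  obtain ⟨y, rfl⟩ := hφ x
  have h1 := hS y v hv
  rw [hact] at h1
  simpa using S.sub_mem h1 (S.smul_mem (χ y) hv)

end Generic

/-! ### The Lie algebra `T` as a Hamiltonian family; its irreducible modules. -/

namespace JetModule

noncomputable section

variable {N : ℕ} (B : Matrix (Fin N) (Fin N) ℂ)

theorem cvec_single (i : Fin N) : cvec (Pi.single i 1) = Pi.single i 1 := by
  ext j
  rcases eq_or_ne j i with rfl | h
  · simp [cvec]
  · simp [cvec, h]

/-- The pairing `(Br|s)` on `ℤ^N`. -/
def latticeForm : (Fin N → ℤ) →+ (Fin N → ℤ) →+ ℂ :=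
  AddMonoidHom.mk' (fun r => AddMonoidHom.mk' (fun s => (B *ᵥ cvec r) ⬝ᵥ cvec s) (by
    intro s t; rw [cvec_add, dotProduct_add])) (by
    intro r s
    refine AddMonoidHom.ext fun t => ?_
    change (B *ᵥ cvec (r + s)) ⬝ᵥ cvec t = (B *ᵥ cvec r) ⬝ᵥ cvec t + (B *ᵥ cvec s) ⬝ᵥ cvec t
    rw [cvec_add, Matrix.mulVec_add, add_dotProduct])

theorem latticeForm_apply (r s : Fin N → ℤ) :
    latticeForm B r s = (B *ᵥ cvec r) ⬝ᵥ cvec s := rfl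

variable {B}

theorem latticeForm_self (hB : Bᵀ = -B) (r : Fin N → ℤ) : latticeForm B r r = 0 := by
  have := skew_dot hB (cvec r) (cvec r)
  rw [latticeForm_apply]
  linear_combination this / 2

theorem exists_latticeForm_ne_zero (hnd : B.Nondegenerate) (x : Fin N → ℤ) (hx : x ≠ 0) :
    ∃ t, latticeForm B t x ≠ 0 := by
  by_contra! h
  have h1 : cvec x ᵥ* B = 0 := by
    ext i
    have := h (Pi.single i 1)
    rw [latticeForm_apply, cvec_single, dotProduct_comm, Matrix.dotProduct_mulVec] at this
    simpa using this
  have h2 := Matrix.separatingLeft_iff_forall_vecMul_eq_zero.mp hnd.separatingLeft _ h1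
  apply hx
  ext i
  simpa [cvec] using congrFun h2 i

theorem T_zero (hB : Bᵀ = -B) : T B hB 0 = 0 := by
  refine Subtype.ext ?_
  change TElem B hB 0 = 0
  have hd : d B hB (B *ᵥ cvec 0) = h B hB 0 := rfl
  rw [TElem, hd, neg_zero, toEnv_k_zero, one_mul, sub_self]

theorem T_lie (hB : Bᵀ = -B) (r s : Fin N → ℤ) :
    ⁅T B hB r, T B hB s⁆ = latticeForm B r s • (T B hB (r + s) - T B hB r - T B hB s) :=
  Subtype.ext (TElem_lie B hB r s)

theorem span_T (hB : Bᵀ = -B) : Submodule.span ℂ (Set.range (T B hB)) = ⊤ := by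
  rw [← Submodule.map_injective_of_injective
    (f := (TAlg B hB).toSubmodule.subtype) Subtype.val_injective |>.eq_iff, Submodule.map_span,
    Submodule.map_top, Submodule.range_subtype, ← Set.range_comp]
  rfl

theorem exists_finsupp_sum_T (hB : Bᵀ = -B) (x : TAlg B hB) :
    ∃ a : (Fin N → ℤ) →₀ ℂ, (a.sum fun r c => c • T B hB r) = x := by
  have hx : x ∈ Submodule.span ℂ (Set.range (T B hB)) := span_T hB ▸ Submodule.mem_top
  exact Finsupp.mem_span_range_iff_exists_finsupp.mp hx

theorem isHamiltonianFamily_T (hB : Bᵀ = -B) (hnd : B.Nondegenerate) :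
    IsHamiltonianFamily (latticeForm B) (T B hB) where
  alt := latticeForm_self hB
  nondeg := exists_latticeForm_ne_zero hnd
  apply_zero := T_zero hB
  lie := T_lie hB
  span := span_T hB

/-- With `M = ∑ a_r r rᵀ` the hypothesis reads `M Bᵀ = 0`, and `B` is invertible. -/
theorem second_moments_eq_zero (hnd : B.Nondegenerate) (a : (Fin N → ℤ) →₀ ℂ)
    (ha : (a.sum fun r c => c • rankOne B r) = 0) (i j : Fin N) :
    (a.sum fun r c => c * ((r i : ℂ) * (r j : ℂ))) = 0 := by
  have h1 : (B *ᵥ fun j => a.sum fun r c => c * ((r i : ℂ) * (r j : ℂ))) = 0 := by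
    ext l
    have := congrFun (congrFun ha i) l
    simp only [Finsupp.sum, Matrix.sum_apply, Matrix.smul_apply, rankOne,
      Matrix.vecMulVec_apply, Matrix.zero_apply, Matrix.mulVec, dotProduct, smul_eq_mul,
      Finset.mul_sum] at this
    simp only [Finsupp.sum, Matrix.mulVec, dotProduct, Finset.mul_sum, Pi.zero_apply]
    rw [Finset.sum_comm, ← this]
    refine Finset.sum_congr rfl fun r _ => Finset.sum_congr rfl fun j _ => ?_
    simp only [cvec]
    ring
  exact congrFun (Matrix.separatingRight_iff_forall_mulVec_eq_zero.mp hnd.separatingRight _ h1) j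

section Representations

variable (hB : Bᵀ = -B) (V : Type*) [AddCommGroup V] [Module ℂ V] [FiniteDimensional ℂ V]
  [LieRingModule (TAlg B hB) V] [LieModule ℂ (TAlg B hB) V]

variable {V}

/-- Writing `x = ∑ a_r T(r)`, the condition `ψ x = 0` is a linear relation among the `r (Br)ᵀ`, so
the second moments of `a` vanish. This is why `ker ψ` acts by scalars. -/
theorem traceFree_eq_zero_of_mem_ker (hnd : B.Nondegenerate)
    (hV : LieModule.IsIrreducible ℂ (TAlg B hB) V) (ψ : TAlg B hB →ₗ⁅ℂ⁆ GB B)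
    (hψ : ∀ r, (ψ (T B hB r) : Matrix (Fin N) (Fin N) ℂ) = rankOne B r) (x : TAlg B hB)
    (hx : ψ x = 0) : LieModule.traceFree (TAlg B hB) V x = 0 := by
  obtain ⟨a, rfl⟩ := exists_finsupp_sum_T hB x
  refine (isHamiltonianFamily_T hB hnd).traceFree_eq_zero hV a (second_moments_eq_zero hnd a ?_)
  have h1 := LinearMap.map_finsupp_sum_smul
    ((GB B).toSubmodule.subtype ∘ₗ (ψ : TAlg B hB →ₗ[ℂ] GB B)) a (T B hB)
  have h2 : ((GB B).toSubmodule.subtype ∘ₗ (ψ : TAlg B hB →ₗ[ℂ] GB B))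
      (a.sum fun r c => c • T B hB r) = 0 := congrArg Subtype.val hx
  rw [h2] at h1
  rw [h1]
  exact Finsupp.sum_congr fun r _ => congrArg _ (hψ r).symm

/-- The trace-free part descends along `ψ` to `𝔊_B`; the normalized trace is `χ`. -/
theorem exists_symplectic_action (hnd : B.Nondegenerate)
    (hV : LieModule.IsIrreducible ℂ (TAlg B hB) V) (ψ : TAlg B hB →ₗ⁅ℂ⁆ GB B)
    (hψ : ∀ r, (ψ (T B hB r) : Matrix (Fin N) (Fin N) ℂ) = rankOne B r)
    (hsurj : Function.Surjective ψ) {K : Type*} [LieRing K] [LieAlgebra ℂ K]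
    (Φ : GB B ≃ₗ⁅ℂ⁆ K) :
    ∃ (_ : LieRingModule K V) (_ : LieModule ℂ K V) (χ : TAlg B hB →ₗ⁅ℂ⁆ ℂ),
      LieModule.IsIrreducible ℂ K V ∧
        ∀ (x : TAlg B hB) (v : V), ⁅x, v⁆ = ⁅Φ (ψ x), v⁆ + χ x • v := by
  obtain ⟨f, hf⟩ := LieHom.exists_factor ψ hsurj (LieModule.traceFree (TAlg B hB) V)
    (traceFree_eq_zero_of_mem_ker hB hnd hV ψ hψ)
  let g : K →ₗ⁅ℂ⁆ Module.End ℂ V := f.comp (Φ.symm : K →ₗ⁅ℂ⁆ GB B)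
  let i1 : LieRingModule K V := LieRingModule.compLieHom V g
  have i2 : LieModule ℂ K V := LieModule.compLieHom V g
  have hact : ∀ (x : TAlg B hB) (v : V),
      ⁅x, v⁆ = ⁅Φ (ψ x), v⁆ + LieModule.normTrace (TAlg B hB) V x • v := by
    intro x v
    rw [LieModule.lie_eq_traceFree_add, ← hf]
    congr 1
    change f (ψ x) v = f (Φ.symm (Φ (ψ x))) v
    rw [LieEquiv.symm_apply_apply]
  refine ⟨i1, i2, LieModule.normTrace (TAlg B hB) V, ?_, hact⟩
  refine LieModule.isIrreducible_of_stable hV fun W hW x v hv => ?_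
  rw [hact]
  exact W.add_mem (hW _ v hv) (W.smul_mem _ hv)

end Representations

end

end JetModule

/-! ### Symplectic bases. -/

section SymplecticBasis

/-- A non-degenerate alternating form on a space of dimension at least `2k` admits `k` mutually
orthogonal hyperbolic pairs. -/
theorem exists_hyperbolic_pairs {V : Type*} [AddCommGroup V] [Module ℂ V] [FiniteDimensional ℂ V]
    (ω : V →ₗ[ℂ] V →ₗ[ℂ] ℂ) (halt : ∀ x, ω x x = 0) (hnd : ∀ x, x ≠ 0 → ∃ y, ω x y ≠ 0) (k : ℕ)
    (hk : 2 * k ≤ Module.finrank ℂ V) :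
    ∃ e f : Fin k → V, (∀ i j, ω (e i) (e j) = 0) ∧ (∀ i j, ω (f i) (f j) = 0) ∧
      ∀ i j, ω (e i) (f j) = if i = j then 1 else 0 := by
  have skew : ∀ x y, ω x y = -ω y x := by
    intro x y
    have := halt (x + y)
    simp only [map_add, LinearMap.add_apply, halt] at this
    linear_combination this
  induction k with
  | zero => exact ⟨Fin.elim0, Fin.elim0, fun i => i.elim0, fun i => i.elim0, fun i => i.elim0⟩
  | succ k ih =>
    obtain ⟨e, f, hee, hff, hef⟩ := ih (by omega)
    let g : V →ₗ[ℂ] (Fin k ⊕ Fin k → ℂ) :=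
      LinearMap.pi (Sum.elim (fun i => ω (e i)) fun i => ω (f i))
    -- Orthogonality to the `k` pairs imposes `2k` conditions on a space of dimension at least `2k +
    -- 2`.
    have hker : LinearMap.ker g ≠ ⊥ := LinearMap.ker_ne_bot_of_finrank_lt (by
      rw [Module.finrank_fintype_fun_eq_card, Fintype.card_sum, Fintype.card_fin]; omega)
    obtain ⟨w, hw, hw0⟩ := Submodule.exists_mem_ne_zero_of_ne_bot hker
    have hwe : ∀ i, ω (e i) w = 0 := fun i => congrFun (LinearMap.mem_ker.mp hw) (Sum.inl i)
    have hwf : ∀ i, ω (f i) w = 0 := fun i => congrFun (LinearMap.mem_ker.mp hw) (Sum.inr i)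
    obtain ⟨x, hx⟩ := hnd w hw0
    -- The component of `x` orthogonal to the earlier pairs; its pairing with `w` is unchanged.
    let y := x - ∑ i, ω x (f i) • e i + ∑ i, ω x (e i) • f i
    have hye : ∀ j, ω (e j) y = 0 := by
      intro j
      simp only [y, map_add, map_sub, map_sum, map_smul, hee, hef, smul_eq_mul, mul_zero,
        Finset.sum_const_zero, mul_ite, mul_one, Finset.sum_ite_eq, Finset.mem_univ, if_true]
      rw [skew x (e j)]; ring
    have hyf : ∀ j, ω (f j) y = 0 := by
      intro j
      have hfe : ∀ i j, ω (f i) (e j) = if j = i then -1 else 0 := by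
        intro i j; rw [skew, hef]; split_ifs <;> simp
      simp only [y, map_add, map_sub, map_sum, map_smul, hff, hfe, smul_eq_mul, mul_zero,
        Finset.sum_const_zero, mul_ite, Finset.sum_ite_eq', Finset.mem_univ, if_true]
      rw [skew x (f j)]; ring
    have hwy : ω w y = ω w x := by
      have h1 : ∀ i, ω w (e i) = 0 := fun i => by rw [skew, hwe, neg_zero]
      have h2 : ∀ i, ω w (f i) = 0 := fun i => by rw [skew, hwf, neg_zero]
      simp [y, h1, h2]
    refine ⟨Fin.cons w e, Fin.cons ((ω w x)⁻¹ • y) f, ?_, ?_, ?_⟩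
    · intro i j
      refine Fin.cases ?_ (fun i => ?_) i <;> refine Fin.cases ?_ (fun j => ?_) j
      · simp [halt]
      · simp [skew w, hwe]
      · simp [hwe]
      · simp [hee]
    · intro i j
      refine Fin.cases ?_ (fun i => ?_) i <;> refine Fin.cases ?_ (fun j => ?_) j
      · simp [halt]
      · simp [skew y, hyf]
      · simp [hyf]
      · simp [hff]
    · intro i j
      refine Fin.cases ?_ (fun i => ?_) i <;> refine Fin.cases ?_ (fun j => ?_) j
      · simp [hwy, hx]
      · simp [skew w, hwf, (Fin.succ_ne_zero _).symm]
      · simp [hye, Fin.succ_ne_zero]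
      · simp [hef]

theorem Matrix.exists_transpose_mul_mul_eq_J {m : ℕ}
    (B : Matrix (Fin m ⊕ Fin m) (Fin m ⊕ Fin m) ℂ) (hB : Bᵀ = -B) (hnd : B.Nondegenerate) :
    ∃ P : Matrix (Fin m ⊕ Fin m) (Fin m ⊕ Fin m) ℂ, IsUnit P ∧ Pᵀ * B * P = Matrix.J (Fin m) ℂ := by
  let ω : (Fin m ⊕ Fin m → ℂ) →ₗ[ℂ] (Fin m ⊕ Fin m → ℂ) →ₗ[ℂ] ℂ := Matrix.toLinearMap₂' ℂ B
  have hω : ∀ x y, ω x y = x ⬝ᵥ B *ᵥ y := fun x y => Matrix.toLinearMap₂'_apply' B x y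
  have hskew : ∀ x y, ω x y = -ω y x := by
    intro x y
    rw [hω, hω, Matrix.dotProduct_mulVec, ← Matrix.mulVec_transpose, hB, Matrix.neg_mulVec,
      neg_dotProduct, dotProduct_comm]
  obtain ⟨e, f, hee, hff, hef⟩ := exists_hyperbolic_pairs ω
    (fun x => by linear_combination (hskew x x) / 2)
    (fun x hx => by
      obtain ⟨y, hy⟩ := hnd.exists_not_ortho_of_ne_zero hx
      exact ⟨y, by rwa [hω]⟩) m (by simp [two_mul])
  -- The `f`'s come before the `e`'s because `J` has `-1` in its upper right block and `ω(f_i, e_i)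
  -- = -1`.
  let P : Matrix (Fin m ⊕ Fin m) (Fin m ⊕ Fin m) ℂ := Matrix.of fun a b => Sum.elim f e b a
  have hP : Pᵀ * B * P = Matrix.J (Fin m) ℂ := by
    have h1 : ∀ i j, (Pᵀ * B * P) i j = ω (Sum.elim f e i) (Sum.elim f e j) := by
      intro i j
      rw [hω, Matrix.mul_assoc]
      rfl
    ext i j
    rw [h1]
    rcases i with i | i <;> rcases j with j | j
    · simp [Matrix.J, hff]
    · simp only [Sum.elim_inl, Sum.elim_inr, Matrix.J, Matrix.fromBlocks_apply₁₂]
      rw [hskew, hef, Matrix.neg_apply, Matrix.one_apply]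
      simp only [eq_comm]
    · simp only [Sum.elim_inl, Sum.elim_inr, Matrix.J, Matrix.fromBlocks_apply₂₁]
      rw [hef, Matrix.one_apply]
    · simp [Matrix.J, hee]
  refine ⟨P, ?_, hP⟩
  rw [Matrix.isUnit_iff_isUnit_det]
  have h2 := congrArg Matrix.det hP
  rw [Matrix.det_mul] at h2
  have h3 : IsUnit (Matrix.J (Fin m) ℂ).det := Matrix.isUnit_det_J _ _
  rw [← h2] at h3
  exact isUnit_of_mul_isUnit_right h3

end SymplecticBasis

/-! ### The isomorphism `𝔊_B ≅ sp_{2m}` and the homomorphism `ψ_B`. -/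

namespace JetModule

noncomputable section

/-- Congruent forms have isomorphic skew-adjoint algebras, and `B` is congruent to `J` after
reindexing. -/
theorem nonempty_GB_equiv_sp (m : ℕ) (B : Matrix (Fin (2 * m)) (Fin (2 * m)) ℂ) (hB : Bᵀ = -B)
    (hnd : B.Nondegenerate) : Nonempty (GB B ≃ₗ⁅ℂ⁆ LieAlgebra.Symplectic.sp (Fin m) ℂ) := by
  let e : Fin (2 * m) ≃ Fin m ⊕ Fin m := (finCongr (two_mul m)).trans finSumFinEquiv.symm
  have hB' : (Matrix.reindexAlgEquiv ℂ ℂ e B)ᵀ = -Matrix.reindexAlgEquiv ℂ ℂ e B := by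
    rw [← map_neg, ← hB]; rfl
  have hnd' : (Matrix.reindexAlgEquiv ℂ ℂ e B).Nondegenerate := by
    rw [Matrix.nondegenerate_iff_det_ne_zero] at hnd ⊢
    rwa [Matrix.det_reindexAlgEquiv]
  obtain ⟨P, hP, hPJ⟩ := Matrix.exists_transpose_mul_mul_eq_J _ hB' hnd'
  have E1 := skewAdjointMatricesLieSubalgebraEquivTranspose B (Matrix.reindexAlgEquiv ℂ ℂ e)
    (fun A => rfl)
  have E2 := skewAdjointMatricesLieSubalgebraEquiv (Matrix.reindexAlgEquiv ℂ ℂ e B) P hP.invertible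
  rw [hPJ] at E2
  exact ⟨E1.trans E2⟩

variable {N : ℕ} {B : Matrix (Fin N) (Fin N) ℂ}

theorem rankOne_mem_GB (hB : Bᵀ = -B) (r : Fin N → ℤ) : rankOne B r ∈ GB B := by
  rw [mem_GB, rankOne, Matrix.mul_vecMulVec, Matrix.transpose_vecMulVec, Matrix.vecMulVec_mul,
    ← Matrix.mulVec_transpose, hB, Matrix.neg_mulVec, Matrix.vecMulVec_neg, neg_neg]

theorem rankOne_lie (hB : Bᵀ = -B) (r s : Fin N → ℤ) :
    ⁅rankOne B r, rankOne B s⁆ =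
      latticeForm B r s • (rankOne B (r + s) - rankOne B r - rankOne B s) := by
  have h1 := skew_dot hB (cvec s) (cvec r)
  rw [latticeForm_apply, LieRing.of_associative_ring_bracket]
  simp only [rankOne, Matrix.vecMulVec_mul_vecMulVec, h1, cvec_add, Matrix.mulVec_add]
  ext i j
  simp only [Matrix.sub_apply, Matrix.smul_apply, Matrix.vecMulVec_apply, Pi.add_apply,
    Pi.smul_apply, smul_eq_mul]
  ring

/-- The operator by which an element of `H̃_B ⋉ A` acts on the first factor of `A ⊗ A`. -/
def leftAction (hB : Bᵀ = -B) (x : JetAlg B hB) : Module.End ℂ (Laurent N) :=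
  LinearMap.mulLeft ℂ x.left + ((x.right : Derivation ℂ (Laurent N) (Laurent N)) :
    Laurent N →ₗ[ℂ] Laurent N)

/-- The operator by which an element of `H̃_B ⋉ A` acts on the second factor of `A ⊗ A`. -/
def rightAction (hB : Bᵀ = -B) (x : JetAlg B hB) : Module.End ℂ (Laurent N) :=
  ((x.right : Derivation ℂ (Laurent N) (Laurent N)) : Laurent N →ₗ[ℂ] Laurent N)

theorem leftAction_lie (hB : Bᵀ = -B) (x y : JetAlg B hB) :
    leftAction hB ⁅x, y⁆ = leftAction hB x * leftAction hB y - leftAction hB y * leftAction hB x := by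
  refine LinearMap.ext fun f => ?_
  obtain ⟨a, X⟩ := x
  obtain ⟨b, Y⟩ := y
  change (⁅a, b⁆ + X.1 b - Y.1 a) * f + ⁅X.1, Y.1⁆ f =
    (a * (b * f + Y.1 f) + X.1 (b * f + Y.1 f)) - (b * (a * f + X.1 f) + Y.1 (a * f + X.1 f))
  rw [Ring.lie_def, Derivation.commutator_apply]
  simp only [map_add, Derivation.leibniz, smul_eq_mul]
  ring

theorem rightAction_lie (hB : Bᵀ = -B) (x y : JetAlg B hB) :
    rightAction hB ⁅x, y⁆ =
      rightAction hB x * rightAction hB y - rightAction hB y * rightAction hB x := by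
  refine LinearMap.ext fun f => ?_
  obtain ⟨a, X⟩ := x
  obtain ⟨b, Y⟩ := y
  change ⁅X.1, Y.1⁆ f = X.1 (Y.1 f) - Y.1 (X.1 f)
  rw [Derivation.commutator_apply]

/-- The jet module `A ⊗ A`, on which derivations act by the Leibniz rule and `A` acts on the first
factor. -/
def pairAction (hB : Bᵀ = -B) : JetAlg B hB →ₗ⁅ℂ⁆ Module.End ℂ (Laurent N ⊗[ℂ] Laurent N) where
  toFun x := (leftAction hB x).rTensor (Laurent N) + (rightAction hB x).lTensor (Laurent N)
  map_add' x y := by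
    have h1 : leftAction hB (x + y) = leftAction hB x + leftAction hB y := by
      refine LinearMap.ext fun f => ?_
      change (x.left + y.left) * f + (x.right.1 + y.right.1) f =
        (x.left * f + x.right.1 f) + (y.left * f + y.right.1 f)
      rw [Derivation.add_apply, add_mul]; abel
    have h2 : rightAction hB (x + y) = rightAction hB x + rightAction hB y := rfl
    rw [h1, h2, LinearMap.rTensor_add, LinearMap.lTensor_add]; abel
  map_smul' c x := by
    have h1 : leftAction hB (c • x) = c • leftAction hB x := by
      refine LinearMap.ext fun f => ?_
      change (c • x.left) * f + (c • x.right.1) f = c • (x.left * f + x.right.1 f)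
      rw [Derivation.smul_apply, smul_add, smul_mul_assoc]
    have h2 : rightAction hB (c • x) = c • rightAction hB x := rfl
    rw [h1, h2, LinearMap.rTensor_smul, LinearMap.lTensor_smul, smul_add, RingHom.id_apply]
  map_lie' {x y} := by
    rw [leftAction_lie, rightAction_lie, LieRing.of_associative_ring_bracket,
      LinearMap.rTensor_sub, LinearMap.lTensor_sub]
    simp only [Module.End.mul_eq_comp, LinearMap.rTensor_comp, LinearMap.lTensor_comp,
      LinearMap.comp_add, LinearMap.add_comp]
    simp only [← LinearMap.rTensor_comp, ← LinearMap.lTensor_comp, LinearMap.rTensor_comp_lTensor,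
      LinearMap.lTensor_comp_rTensor]
    abel

theorem pairAction_k (hB : Bᵀ = -B) (r : Fin N → ℤ) :
    pairAction hB (k B hB r) = (LinearMap.mulLeft ℂ (mono r)).rTensor (Laurent N) := by
  have h1 : leftAction hB (k B hB r) = LinearMap.mulLeft ℂ (mono r) := by
    refine LinearMap.ext fun f => ?_
    change mono r * f + (0 : Derivation ℂ (Laurent N) (Laurent N)) f = mono r * f
    rw [Derivation.zero_apply, add_zero]
  have h2 : rightAction hB (k B hB r) = 0 := rfl
  change LinearMap.rTensor _ _ + LinearMap.lTensor _ _ = _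
  rw [h1, h2, LinearMap.lTensor_zero, add_zero]

/-- The action of `U'` on `A ⊗ A`. -/
def pairEnvAction (hB : Bᵀ = -B) : JetEnv B hB →ₐ[ℂ] Module.End ℂ (Laurent N ⊗[ℂ] Laurent N) :=
  RingQuot.liftAlgHom ℂ ⟨UniversalEnvelopingAlgebra.lift ℂ (pairAction hB), by
    rintro _ _ (⟨r, s⟩ | _)
    · rw [map_mul, UniversalEnvelopingAlgebra.lift_ι_apply, UniversalEnvelopingAlgebra.lift_ι_apply,
        UniversalEnvelopingAlgebra.lift_ι_apply, pairAction_k, pairAction_k, pairAction_k,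
        Module.End.mul_eq_comp, ← LinearMap.rTensor_comp, ← mono_mul, LinearMap.mulLeft_mul]
    · rw [map_one, UniversalEnvelopingAlgebra.lift_ι_apply, pairAction_k, mono_zero,
        LinearMap.mulLeft_one, LinearMap.rTensor_id]; rfl⟩

theorem pairEnvAction_toEnv (hB : Bᵀ = -B) (x : JetAlg B hB) :
    pairEnvAction hB (toEnv B hB x) = pairAction hB x := by
  change RingQuot.liftAlgHom ℂ _ (RingQuot.mkAlgHom ℂ _ (UniversalEnvelopingAlgebra.ι ℂ x)) = _
  rw [RingQuot.liftAlgHom_mkAlgHom_apply, UniversalEnvelopingAlgebra.lift_ι_apply]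

/-- Linear relations among the `T(r)` in `U'` are not known in advance, so `ψ_B` has to be read off
from an action of `U'`. Here the functional `t^a ⊗ t^b ↦ b_i` yields `(Br|q) r_i`, which at `q =
e_j` is the `(i, j)` entry of `r (Br)ᵀ`. -/
theorem pairEnvAction_TElem (hB : Bᵀ = -B) (r q : Fin N → ℤ) :
    pairEnvAction hB (TElem B hB r) (mono 0 ⊗ₜ mono q) =
      ((B *ᵥ cvec r) ⬝ᵥ cvec q) • (mono (-r) ⊗ₜ mono (r + q) - mono 0 ⊗ₜ mono q) := by
  have hh : pairAction hB (h B hB r) (mono 0 ⊗ₜ mono q) =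
      ((B *ᵥ cvec r) ⬝ᵥ cvec q) • (mono 0 ⊗ₜ mono (r + q)) := by
    change (0 * mono 0 + D (B *ᵥ cvec r) r (mono 0)) ⊗ₜ mono q +
      mono 0 ⊗ₜ D (B *ᵥ cvec r) r (mono q) = _
    rw [D_mono, D_mono, cvec_zero, dotProduct_zero, zero_smul, zero_mul, add_zero,
      TensorProduct.zero_tmul, zero_add, TensorProduct.tmul_smul]
  have hd : pairAction hB (d B hB (B *ᵥ cvec r)) (mono 0 ⊗ₜ mono q) =
      ((B *ᵥ cvec r) ⬝ᵥ cvec q) • (mono 0 ⊗ₜ mono q) := by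
    change (0 * mono 0 + D (B *ᵥ cvec r) 0 (mono 0)) ⊗ₜ mono q +
      mono 0 ⊗ₜ D (B *ᵥ cvec r) 0 (mono q) = _
    rw [D_mono, D_mono, cvec_zero, dotProduct_zero, zero_smul, zero_mul, add_zero,
      TensorProduct.zero_tmul, zero_add, TensorProduct.tmul_smul, zero_add]
  rw [TElem, map_sub, map_mul, pairEnvAction_toEnv, pairEnvAction_toEnv, pairEnvAction_toEnv,
    LinearMap.sub_apply, Module.End.mul_apply, hh, hd, map_smul, pairAction_k,
    LinearMap.rTensor_tmul, LinearMap.mulLeft_apply, mono_mul, add_zero, smul_sub]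

/-- The linear functional on `A` with prescribed values on monomials. -/
def functional (g : (Fin N → ℤ) → ℂ) : Laurent N →ₗ[ℂ] ℂ :=
  (AddMonoidAlgebra.basis (Fin N → ℤ) ℂ).constr ℂ g

theorem functional_mono (g : (Fin N → ℤ) → ℂ) (s : Fin N → ℤ) : functional g (mono s) = g s := by
  have h : mono s = AddMonoidAlgebra.basis (Fin N → ℤ) ℂ s := by simp [mono]
  rw [functional, h, Module.Basis.constr_basis]

/-- The functional `t^a ⊗ t^b ↦ b_i` on `A ⊗ A`. -/
def pairFunctional (i : Fin N) : Laurent N ⊗[ℂ] Laurent N →ₗ[ℂ] ℂ :=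
  TensorProduct.lift ((functional fun _ => 1).smulRight (functional fun s => (s i : ℂ)))

theorem pairFunctional_mono (i : Fin N) (a b : Fin N → ℤ) :
    pairFunctional i (mono a ⊗ₜ mono b) = b i := by
  rw [pairFunctional, TensorProduct.lift.tmul, LinearMap.smulRight_apply, functional_mono,
    LinearMap.smul_apply, functional_mono, one_smul]

/-- The linear map from `U'` to matrices sending `T(r)` to `r (Br)ᵀ`. -/
def envMatrix (hB : Bᵀ = -B) : JetEnv B hB →ₗ[ℂ] Matrix (Fin N) (Fin N) ℂ where
  toFun x := Matrix.of fun i j =>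
    pairFunctional i (pairEnvAction hB x (mono 0 ⊗ₜ mono (Pi.single j 1)))
  map_add' x y := by ext i j; simp
  map_smul' c x := by ext i j; simp

theorem envMatrix_TElem (hB : Bᵀ = -B) (r : Fin N → ℤ) :
    envMatrix hB (TElem B hB r) = rankOne B r := by
  ext i j
  change pairFunctional i (pairEnvAction hB (TElem B hB r) (mono 0 ⊗ₜ mono (Pi.single j 1))) = _
  rw [pairEnvAction_TElem, map_smul, map_sub, pairFunctional_mono, pairFunctional_mono,
    cvec_single, rankOne, Matrix.vecMulVec_apply]
  simp [cvec, mul_comm]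

theorem envMatrix_mem_GB (hB : Bᵀ = -B) (x : TAlg B hB) : envMatrix hB x.1 ∈ GB B := by
  have hx : x.1 ∈ Submodule.span ℂ (Set.range (TElem B hB)) := x.2
  have : Submodule.span ℂ (Set.range (TElem B hB)) ≤
      (GB B).toSubmodule.comap (envMatrix hB) := by
    rw [Submodule.span_le]
    rintro _ ⟨r, rfl⟩
    change envMatrix hB (TElem B hB r) ∈ GB B
    rw [envMatrix_TElem]
    exact rankOne_mem_GB hB r
  exact this hx

theorem envMatrix_lie (hB : Bᵀ = -B) (x y : TAlg B hB) :
    envMatrix hB ⁅x.1, y.1⁆ = ⁅envMatrix hB x.1, envMatrix hB y.1⁆ := by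
  have hx : x.1 ∈ Submodule.span ℂ (Set.range (TElem B hB)) := x.2
  have hy : y.1 ∈ Submodule.span ℂ (Set.range (TElem B hB)) := y.2
  generalize x.1 = x at hx
  generalize y.1 = y at hy
  induction hx using Submodule.span_induction with
  | mem x hx =>
    obtain ⟨r, rfl⟩ := hx
    induction hy using Submodule.span_induction with
    | mem y hy =>
      obtain ⟨s, rfl⟩ := hy
      rw [TElem_lie, map_smul, map_sub, map_sub, envMatrix_TElem, envMatrix_TElem,
        envMatrix_TElem, rankOne_lie hB, latticeForm_apply]
    | zero => rw [lie_zero, map_zero, lie_zero]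
    | add y z _ _ hy hz => rw [lie_add, map_add, map_add, lie_add, hy, hz]
    | smul c y _ hy => rw [lie_smul, map_smul, map_smul, lie_smul, hy]
  | zero => rw [zero_lie, map_zero, zero_lie]
  | add y z _ _ hy hz => rw [add_lie, map_add, map_add, add_lie, hy, hz]
  | smul c y _ hy => rw [smul_lie, map_smul, map_smul, smul_lie, hy]

/-- The homomorphism `ψ_B : T → 𝔊_B` with `T(r) ↦ r (Br)ᵀ`. -/
def psi (hB : Bᵀ = -B) : TAlg B hB →ₗ⁅ℂ⁆ GB B where
  toFun x := ⟨envMatrix hB x.1, envMatrix_mem_GB hB x⟩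
  map_add' x y := Subtype.ext (map_add (envMatrix hB) x.1 y.1)
  map_smul' c x := Subtype.ext (map_smul (envMatrix hB) c x.1)
  map_lie' {x y} := Subtype.ext (envMatrix_lie hB x y)

theorem psi_T (hB : Bᵀ = -B) (r : Fin N → ℤ) :
    (psi hB (T B hB r) : Matrix (Fin N) (Fin N) ℂ) = rankOne B r :=
  envMatrix_TElem hB r

/-- As `r (Br)ᵀ = r rᵀ Bᵀ`, polarisation gives `(E_ij + E_ji) Bᵀ`; the `1/2` compensates for summing
over ordered pairs. -/
theorem sum_smul_polar_rankOne (Y : Matrix (Fin N) (Fin N) ℂ) (hY : Yᵀ = Y) :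
    (∑ i, ∑ j, (Y i j / 2) • (rankOne B (Pi.single i 1 + Pi.single j 1) -
      rankOne B (Pi.single i 1) - rankOne B (Pi.single j 1))) = Y * Bᵀ := by
  ext a b
  have hp : ∀ i j, (rankOne B (Pi.single i 1 + Pi.single j 1) -
      rankOne B (Pi.single i 1) - rankOne B (Pi.single j 1)) a b =
      (Pi.single i 1 : Fin N → ℂ) a * B b j + (Pi.single j 1 : Fin N → ℂ) a * B b i := by
    intro i j
    simp only [rankOne, Matrix.sub_apply, Matrix.vecMulVec_apply, cvec_add, cvec_single,
      Matrix.mulVec_add, Pi.add_apply, Matrix.mulVec_single_one, Matrix.col_apply]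
    ring
  simp only [Matrix.sum_apply, Matrix.smul_apply, hp, smul_eq_mul, mul_add, Finset.sum_add_distrib]
  have h1 : ∑ i, ∑ j, Y i j / 2 * ((Pi.single i 1 : Fin N → ℂ) a * B b j) =
      ∑ j, Y a j / 2 * B b j := by
    rw [Finset.sum_eq_single a]
    · simp
    · intro i _ hi; simp [hi.symm]
    · simp
  have h2 : ∑ i, ∑ j, Y i j / 2 * ((Pi.single j 1 : Fin N → ℂ) a * B b i) =
      ∑ i, Y i a / 2 * B b i := by
    refine Finset.sum_congr rfl fun i _ => ?_
    rw [Finset.sum_eq_single a]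
    · simp
    · intro i _ hi; simp [hi.symm]
    · simp
  have h3 : ∀ i, Y i a = Y a i := fun i => congrFun (congrFun hY a) i
  rw [h1, h2, Matrix.mul_apply, ← Finset.sum_add_distrib]
  refine Finset.sum_congr rfl fun i _ => ?_
  rw [h3, Matrix.transpose_apply]
  ring

/-- An element of `𝔊_B` has the form `Y Bᵀ` with `Y` symmetric, and polarised `T(r)`'s map onto all
such matrices. -/
theorem psi_surjective (hB : Bᵀ = -B) (hnd : B.Nondegenerate) : Function.Surjective (psi hB) := by
  rintro ⟨X, hX⟩
  have hdet : IsUnit B.det := (Matrix.nondegenerate_iff_det_ne_zero.mp hnd).isUnit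
  have hXs := (mem_GB B X).mp hX
  obtain ⟨Y, hYB⟩ : ∃ Y, Y * Bᵀ = X := ⟨-(X * B⁻¹), by
    rw [hB, Matrix.mul_neg, Matrix.neg_mul, neg_neg, Matrix.nonsing_inv_mul_cancel_right _ _ hdet]⟩
  have hXY : X = -(Y * B) := by rw [← hYB, hB, Matrix.mul_neg]
  have hYs : Yᵀ = Y := by
    rw [hXY] at hXs
    simp only [Matrix.transpose_neg, Matrix.transpose_mul, hB, Matrix.mul_neg, Matrix.neg_mul,
      neg_inj, neg_neg] at hXs
    have h1 : B * Y * B = B * Yᵀ * B := by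
      rw [Matrix.mul_assoc, hXs]
    have hBu : IsUnit B := (Matrix.isUnit_iff_isUnit_det B).mpr hdet
    have h2 := hBu.mul_right_cancel h1
    exact (hBu.mul_left_cancel h2).symm
  refine ⟨∑ i, ∑ j, (Y i j / 2) • (T B hB (Pi.single i 1 + Pi.single j 1) -
      T B hB (Pi.single i 1) - T B hB (Pi.single j 1)), ?_⟩
  have hs := sum_smul_polar_rankOne (B := B) Y hYs
  rw [hYB] at hs
  refine Subtype.ext (Eq.trans ?_ hs)
  change ((GB B).toSubmodule.subtype ∘ₗ (psi hB : TAlg B hB →ₗ[ℂ] GB B)) _ = _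
  simp only [map_sum, map_smul, map_sub]
  refine Finset.sum_congr rfl fun i _ => Finset.sum_congr rfl fun j _ => ?_
  rw [← psi_T hB, ← psi_T hB, ← psi_T hB]
  rfl

end

end JetModule

/-! ### Irreducible jet modules as `V₀ ⊗ A`. -/

namespace JetModule

noncomputable section

variable {N : ℕ} {B : Matrix (Fin N) (Fin N) ℂ} {hB : Bᵀ = -B}

theorem jetAlg_mem_span (x : JetAlg B hB) :
    x ∈ Submodule.span ℂ (Set.range (k B hB) ∪ Set.range (h B hB) ∪ Set.range (d B hB)) := by
  set S := Submodule.span ℂ (Set.range (k B hB) ∪ Set.range (h B hB) ∪ Set.range (d B hB))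
  have hx : x = LieAlgebra.SemiDirectSum.inl (hAction B hB) x.left +
      LieAlgebra.SemiDirectSum.inr (hAction B hB) x.right := by
    ext1
    · exact (add_zero x.left).symm
    · exact (zero_add x.right).symm
  rw [hx]
  refine S.add_mem ?_ ?_
  · generalize x.left = a
    induction a using laurent_induction with
    | hm r => exact Submodule.subset_span (Or.inl (Or.inl ⟨r, rfl⟩))
    | hadd f g hf hg => rw [map_add]; exact S.add_mem hf hg
    | hsmul c f hf => rw [map_smul]; exact S.smul_mem c hf
  · obtain ⟨X, hX⟩ := x.right
    have hX' : X ∈ hSpan B ⊔ dSpan N := hX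
    obtain ⟨Y, hY, Z, hZ, rfl⟩ := Submodule.mem_sup.mp hX'
    have hYZ : LieAlgebra.SemiDirectSum.inr (hAction B hB) ⟨Y + Z, hX⟩ =
        LieAlgebra.SemiDirectSum.inr (hAction B hB) ⟨Y, Submodule.mem_sup_left hY⟩ +
        LieAlgebra.SemiDirectSum.inr (hAction B hB) ⟨Z, Submodule.mem_sup_right hZ⟩ := by
      rw [← map_add]; rfl
    change LieAlgebra.SemiDirectSum.inr (hAction B hB) ⟨Y + Z, hX⟩ ∈ S
    rw [hYZ]
    clear hYZ hX hX' hx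
    refine S.add_mem ?_ ?_
    · let L : hSpan B →ₗ[ℂ] JetAlg B hB :=
        (LieAlgebra.SemiDirectSum.inr (hAction B hB) : HTilde B hB →ₗ[ℂ] JetAlg B hB) ∘ₗ
          Submodule.inclusion (le_sup_left (a := hSpan B) (b := dSpan N))
      change L ⟨Y, hY⟩ ∈ S
      induction hY using Submodule.span_induction with
      | mem _ hX => obtain ⟨r, rfl⟩ := hX; exact Submodule.subset_span (Or.inl (Or.inr ⟨r, rfl⟩))
      | zero => exact (map_zero L).symm ▸ S.zero_mem
      | add a b ha hb h1 h2 =>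
        exact (map_add L ⟨a, ha⟩ ⟨b, hb⟩).symm ▸ S.add_mem h1 h2
      | smul c a ha h1 => exact (map_smul L c ⟨a, ha⟩).symm ▸ S.smul_mem c h1
    · let L : dSpan N →ₗ[ℂ] JetAlg B hB :=
        (LieAlgebra.SemiDirectSum.inr (hAction B hB) : HTilde B hB →ₗ[ℂ] JetAlg B hB) ∘ₗ
          Submodule.inclusion (le_sup_right (a := hSpan B) (b := dSpan N))
      change L ⟨Z, hZ⟩ ∈ S
      induction hZ using Submodule.span_induction with
      | mem _ hX => obtain ⟨r, rfl⟩ := hX; exact Submodule.subset_span (Or.inr ⟨Pi.single r 1, rfl⟩)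
      | zero => exact (map_zero L).symm ▸ S.zero_mem
      | add a b ha hb h1 h2 =>
        exact (map_add L ⟨a, ha⟩ ⟨b, hb⟩).symm ▸ S.add_mem h1 h2
      | smul c a ha h1 => exact (map_smul L c ⟨a, ha⟩).symm ▸ S.smul_mem c h1

theorem IsJetModule.lie_k_neg_lie_k {V : Type*} [AddCommGroup V] [LieRingModule (JetAlg B hB) V]
    (hV : IsJetModule hB V) (r : Fin N → ℤ) (v : V) : ⁅k B hB (-r), ⁅k B hB r, v⁆⁆ = v := by
  rw [hV.1, neg_add_cancel, hV.2]

variable {V : Type*} [AddCommGroup V] [Module ℂ V] [LieRingModule (JetAlg B hB) V]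
  [LieModule ℂ (JetAlg B hB) V]

/-- A subspace of an irreducible module stable under all `t^r`, `h_r` and `D(u, 0)` is zero or
everything. -/
theorem eq_top_of_stable (hirr : LieModule.IsIrreducible ℂ (JetAlg B hB) V) (W : Submodule ℂ V)
    (hW : W ≠ ⊥) (hk : ∀ r, ∀ v ∈ W, ⁅k B hB r, v⁆ ∈ W) (hh : ∀ r, ∀ v ∈ W, ⁅h B hB r, v⁆ ∈ W)
    (hd : ∀ u, ∀ v ∈ W, ⁅d B hB u, v⁆ ∈ W) : W = ⊤ := by
  let W' : LieSubmodule ℂ (JetAlg B hB) V :=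
    { W with
      lie_mem := by
        intro x v hv
        change ⁅x, v⁆ ∈ W
        have hx := jetAlg_mem_span x
        induction hx using Submodule.span_induction with
        | mem x hx =>
          rcases hx with (⟨r, rfl⟩ | ⟨r, rfl⟩) | ⟨u, rfl⟩
          · exact hk r v hv
          · exact hh r v hv
          · exact hd u v hv
        | zero => rw [zero_lie]; exact W.zero_mem
        | add x y _ _ hx hy => rw [add_lie]; exact W.add_mem hx hy
        | smul c x _ hx => rw [smul_lie]; exact W.smul_mem c hx }
  rcases hirr.eq_bot_or_eq_top W' with h0 | h0
  · refine absurd ?_ hW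
    rwa [← LieSubmodule.toSubmodule_eq_bot] at h0
  · rwa [← LieSubmodule.toSubmodule_eq_top] at h0

theorem lie_k_mem_weightSpace {μ : Fin N → ℂ} {v : V} (hv : v ∈ weightSpace hB V μ)
    (r : Fin N → ℤ) : ⁅k B hB r, v⁆ ∈ weightSpace hB V (μ + cvec r) := by
  intro u
  rw [leibniz_lie, lie_d_k, hv u, smul_lie, lie_smul, dotProduct_add]
  module

theorem lie_h_mem_weightSpace {μ : Fin N → ℂ} {v : V} (hv : v ∈ weightSpace hB V μ)
    (r : Fin N → ℤ) : ⁅h B hB r, v⁆ ∈ weightSpace hB V (μ + cvec r) := by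
  intro u
  rw [leibniz_lie, lie_d_h, hv u, smul_lie, lie_smul, dotProduct_add]
  module

variable (hB V) in
-- Weight spaces sit inside the joint generalized eigenspaces of the commuting operators `D(e_i,
-- 0)`, which are independent.
theorem iSupIndep_weightSpace : iSupIndep (weightSpace hB V) := by
  have hcomm : ∀ i j : Fin N, Commute (LieModule.toEnd ℂ (JetAlg B hB) V (d B hB (Pi.single i 1)))
      (LieModule.toEnd ℂ (JetAlg B hB) V (d B hB (Pi.single j 1))) := by
    intro i j
    rw [commute_iff_lie_eq, ← LieHom.map_lie, lie_d_d, map_zero]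
  refine (Module.End.independent_iInf_maxGenEigenspace_of_forall_mapsTo
    (fun i : Fin N => LieModule.toEnd ℂ (JetAlg B hB) V (d B hB (Pi.single i 1)))
    fun i j φ => Module.End.mapsTo_maxGenEigenspace_of_comm (hcomm j i) φ).mono ?_
  intro μ v hv
  rw [Submodule.mem_iInf]
  intro i
  rw [Module.End.mem_maxGenEigenspace]
  refine ⟨1, ?_⟩
  rw [pow_one, LinearMap.sub_apply, LieModule.toEnd_apply_apply, hv, single_one_dotProduct]
  exact sub_self _

/-- The action of `U'` on a jet module. -/
def envRep (hV : IsJetModule hB V) : JetEnv B hB →ₐ[ℂ] Module.End ℂ V :=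
  RingQuot.liftAlgHom ℂ ⟨UniversalEnvelopingAlgebra.lift ℂ (LieModule.toEnd ℂ (JetAlg B hB) V), by
    rintro _ _ (⟨r, s⟩ | _)
    · rw [map_mul, UniversalEnvelopingAlgebra.lift_ι_apply, UniversalEnvelopingAlgebra.lift_ι_apply,
        UniversalEnvelopingAlgebra.lift_ι_apply]
      exact LinearMap.ext (hV.1 r s)
    · rw [map_one, UniversalEnvelopingAlgebra.lift_ι_apply]
      exact LinearMap.ext hV.2⟩

theorem envRep_toEnv (hV : IsJetModule hB V) (x : JetAlg B hB) (v : V) :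
    envRep hV (toEnv B hB x) v = ⁅x, v⁆ := by
  have : envRep hV (toEnv B hB x) = LieModule.toEnd ℂ (JetAlg B hB) V x := by
    change RingQuot.liftAlgHom ℂ _ (RingQuot.mkAlgHom ℂ _ (UniversalEnvelopingAlgebra.ι ℂ x)) = _
    rw [RingQuot.liftAlgHom_mkAlgHom_apply, UniversalEnvelopingAlgebra.lift_ι_apply]
  rw [this]; rfl

theorem envRep_TElem (hV : IsJetModule hB V) (r : Fin N → ℤ) (v : V) :
    envRep hV (TElem B hB r) v = ⁅k B hB (-r), ⁅h B hB r, v⁆⁆ - ⁅d B hB (B *ᵥ cvec r), v⁆ := by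
  rw [TElem, map_sub, map_mul, LinearMap.sub_apply, Module.End.mul_apply, envRep_toEnv,
    envRep_toEnv, envRep_toEnv]

theorem envRep_mem_weightSpace (hV : IsJetModule hB V) (β : Fin N → ℂ) (x : TAlg B hB) :
    ∀ v ∈ weightSpace hB V β, envRep hV x.1 v ∈ weightSpace hB V β := by
  intro v hv
  have hx : x.1 ∈ Submodule.span ℂ (Set.range (TElem B hB)) := x.2
  generalize x.1 = x at hx ⊢
  induction hx using Submodule.span_induction with
  | mem x hx =>
    obtain ⟨r, rfl⟩ := hx
    rw [envRep_TElem]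
    refine Submodule.sub_mem _ ?_ ?_
    · have := lie_k_mem_weightSpace (lie_h_mem_weightSpace hv r) (-r)
      rwa [cvec_neg, add_neg_cancel_right] at this
    · rw [hv]; exact Submodule.smul_mem _ _ hv
  | zero => rw [map_zero]; exact Submodule.zero_mem _
  | add x y _ _ hx hy => rw [map_add]; exact Submodule.add_mem _ hx hy
  | smul c x _ hx => rw [map_smul]; exact Submodule.smul_mem _ _ hx

/-- The action of `T` on a weight space of a jet module. -/
def weightRep (hV : IsJetModule hB V) (β : Fin N → ℂ) :
    TAlg B hB →ₗ⁅ℂ⁆ Module.End ℂ (weightSpace hB V β) where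
  toFun x := (envRep hV x.1).restrict (envRep_mem_weightSpace hV β x)
  map_add' x y := by
    refine LinearMap.ext fun v => Subtype.ext ?_
    change envRep hV (x.1 + y.1) v.1 = envRep hV x.1 v.1 + envRep hV y.1 v.1
    rw [map_add]; rfl
  map_smul' c x := by
    refine LinearMap.ext fun v => Subtype.ext ?_
    change envRep hV (c • x.1) v.1 = c • envRep hV x.1 v.1
    rw [map_smul]; rfl
  map_lie' {x y} := by
    refine LinearMap.ext fun v => Subtype.ext ?_
    change envRep hV (x.1 * y.1 - y.1 * x.1) v.1 =
      envRep hV x.1 (envRep hV y.1 v.1) - envRep hV y.1 (envRep hV x.1 v.1)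
    rw [map_sub, map_mul, map_mul]; rfl

theorem weightRep_T (hV : IsJetModule hB V) (β : Fin N → ℂ) (r : Fin N → ℤ)
    (v : weightSpace hB V β) : (weightRep hV β (T B hB r) v : V) =
      ⁅k B hB (-r), ⁅h B hB r, (v : V)⁆⁆ - ((B *ᵥ cvec r) ⬝ᵥ β) • (v : V) := by
  change envRep hV (TElem B hB r) v.1 = _
  rw [envRep_TElem, v.2]

/-- On `V_β` one has `h_r = t^r (T(r) + (Br|β))`; moving `h_r` past `t^s` adds `(Br|s) t^{s+r}`.
This is the formula for `h_r` on the tensor model. -/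
theorem lie_h_lie_k (hV : IsJetModule hB V) (β : Fin N → ℂ) (r s : Fin N → ℤ)
    (v : weightSpace hB V β) : ⁅h B hB r, ⁅k B hB s, (v : V)⁆⁆ =
      ((B *ᵥ cvec r) ⬝ᵥ (cvec s + β)) • ⁅k B hB (s + r), (v : V)⁆ +
        ⁅k B hB (s + r), (weightRep hV β (T B hB r) v : V)⁆ := by
  rw [weightRep_T, lie_sub, hV.1, add_neg_cancel_right, lie_smul, leibniz_lie, lie_h_k, smul_lie,
    add_comm r s, dotProduct_add]
  module

/-- The map `V_β ⊗ A → V`, `v ⊗ f ↦ f v`. -/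
def evalMap (hB : Bᵀ = -B) (V : Type*) [AddCommGroup V] [Module ℂ V]
    [LieRingModule (JetAlg B hB) V] [LieModule ℂ (JetAlg B hB) V] (β : Fin N → ℂ) :
    weightSpace hB V β ⊗[ℂ] Laurent N →ₗ[ℂ] V :=
  TensorProduct.lift (((LieModule.toEnd ℂ (JetAlg B hB) V : JetAlg B hB →ₗ[ℂ] Module.End ℂ V) ∘ₗ
    (LieAlgebra.SemiDirectSum.inl (hAction B hB) : Laurent N →ₗ[ℂ] JetAlg B hB)).flip ∘ₗ
      (weightSpace hB V β).subtype)

theorem evalMap_tmul_mono (β : Fin N → ℂ) (v : weightSpace hB V β) (s : Fin N → ℤ) :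
    evalMap hB V β (v ⊗ₜ mono s) = ⁅k B hB s, (v : V)⁆ := rfl

theorem cvec_injective : Function.Injective (cvec : (Fin N → ℤ) → Fin N → ℂ) := by
  intro r s hrs
  ext i
  simpa [cvec] using congrFun hrs i

/-- Different monomials land in different weight spaces, and each `t^s` is invertible. -/
theorem evalMap_injective (hV : IsJetModule hB V) (β : Fin N → ℂ) :
    Function.Injective (evalMap hB V β) := by
  classical
  rw [injective_iff_map_eq_zero]
  intro x hx
  let E := TensorProduct.equivFinsuppOfBasisRight (R := ℂ) (M := weightSpace hB V β)
    (AddMonoidAlgebra.basis (Fin N → ℤ) ℂ)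
  obtain ⟨c, rfl⟩ := E.symm.surjective x
  have hbasis : ∀ s : Fin N → ℤ, AddMonoidAlgebra.basis (Fin N → ℤ) ℂ s = mono s := fun s => by
    simp [mono]
  rw [TensorProduct.equivFinsuppOfBasisRight_symm_apply, Finsupp.sum, map_sum] at hx
  simp only [hbasis, evalMap_tmul_mono] at hx
  have hind := (iSupIndep_weightSpace hB V).comp (f := fun s : Fin N → ℤ => β + cvec s)
    fun a b hab => cvec_injective (add_left_cancel hab)
  rw [iSupIndep_iff_finsetSum_eq_zero_imp_eq_zero] at hind
  have hc : c = 0 := by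
    ext s
    by_cases hs : s ∈ c.support
    · have := hind c.support (fun s => ⁅k B hB s, (c s : V)⁆)
        (fun s _ => lie_k_mem_weightSpace (c s).2 s) hx s hs
      rw [Finsupp.coe_zero, Pi.zero_apply, ZeroMemClass.coe_zero, ← hV.lie_k_neg_lie_k s (c s : V),
        this, lie_zero]
    · rw [Finsupp.notMem_support_iff.mp hs]; rfl
  rw [hc, map_zero]

/-- A non-zero `T`-stable subspace of a weight space generates an irreducible jet module under the
action of the monomials. -/
theorem span_lie_k_eq_top (hV : IsJetModule hB V)
    (hirr : LieModule.IsIrreducible ℂ (JetAlg B hB) V) (β : Fin N → ℂ)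
    (S : Submodule ℂ (weightSpace hB V β)) (hS : S ≠ ⊥)
    (hST : ∀ r, ∀ v ∈ S, weightRep hV β (T B hB r) v ∈ S) :
    Submodule.span ℂ {x : V | ∃ v ∈ S, ∃ s, x = ⁅k B hB s, (v : V)⁆} = ⊤ := by
  set W := Submodule.span ℂ {x : V | ∃ v ∈ S, ∃ s, x = ⁅k B hB s, (v : V)⁆} with hWdef
  have hmem : ∀ v ∈ S, ∀ s, ⁅k B hB s, (v : V)⁆ ∈ W := fun v hv s =>
    Submodule.subset_span ⟨v, hv, s, rfl⟩
  have stable : ∀ x : JetAlg B hB, (∀ v ∈ S, ∀ s, ⁅x, ⁅k B hB s, (v : V)⁆⁆ ∈ W) →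
      ∀ v ∈ W, ⁅x, v⁆ ∈ W := by
    intro x hx v hv
    have : W ≤ W.comap (LieModule.toEnd ℂ (JetAlg B hB) V x) := by
      conv_lhs => rw [hWdef]
      rw [Submodule.span_le]
      rintro _ ⟨v, hv, s, rfl⟩
      exact hx v hv s
    exact this hv
  refine eq_top_of_stable hirr W ?_ ?_ ?_ ?_
  · obtain ⟨v, hv, hv0⟩ := Submodule.exists_mem_ne_zero_of_ne_bot hS
    refine Submodule.ne_bot_iff _ |>.mpr ⟨v, ?_, fun h0 => hv0 (Subtype.ext h0)⟩
    have := hmem v hv 0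
    rwa [hV.2] at this
  · refine fun r => stable _ fun v hv s => ?_
    rw [hV.1]
    exact hmem v hv _
  · refine fun r => stable _ fun v hv s => ?_
    rw [lie_h_lie_k hV]
    exact W.add_mem (W.smul_mem _ (hmem v hv _)) (hmem _ (hST r v hv) _)
  · refine fun u => stable _ fun v hv s => ?_
    rw [lie_k_mem_weightSpace v.2 s]
    exact W.smul_mem _ (hmem v hv _)

theorem evalMap_surjective (hV : IsJetModule hB V)
    (hirr : LieModule.IsIrreducible ℂ (JetAlg B hB) V) (β : Fin N → ℂ)
    (hβ : weightSpace hB V β ≠ ⊥) : Function.Surjective (evalMap hB V β) := by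
  rw [← LinearMap.range_eq_top, eq_top_iff, ← span_lie_k_eq_top hV hirr β ⊤ (fun h0 => hβ (by
    rw [← Submodule.range_subtype (weightSpace hB V β), ← Submodule.map_top, h0,
      Submodule.map_bot])) (fun _ _ _ => Submodule.mem_top), Submodule.span_le]
  rintro _ ⟨v, -, s, rfl⟩
  exact ⟨v ⊗ₜ mono s, evalMap_tmul_mono β v s⟩

/-- The translates of `S` span `V`. By injectivity of `V_β ⊗ A → V`, a vector `w` of `V_β` comes
only from `w ⊗ 1`, so its `t^0` component, extracted by `π`, is `w` itself and lies in `S`. -/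
theorem eq_top_of_weightRep_stable (hV : IsJetModule hB V)
    (hirr : LieModule.IsIrreducible ℂ (JetAlg B hB) V) (β : Fin N → ℂ)
    (S : Submodule ℂ (weightSpace hB V β)) (hS : S ≠ ⊥)
    (hST : ∀ r, ∀ v ∈ S, weightRep hV β (T B hB r) v ∈ S) : S = ⊤ := by
  let π : weightSpace hB V β ⊗[ℂ] Laurent N →ₗ[ℂ] weightSpace hB V β :=
    (TensorProduct.rid ℂ (weightSpace hB V β)).toLinearMap ∘ₗ
      (functional fun s : Fin N → ℤ => if s = 0 then (1 : ℂ) else 0).lTensor (weightSpace hB V β)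
  have hπ : ∀ (v : weightSpace hB V β) s, π (v ⊗ₜ mono s) = (if s = 0 then (1 : ℂ) else 0) • v := by
    intro v s
    change TensorProduct.rid ℂ (weightSpace hB V β) (LinearMap.lTensor _ _ (v ⊗ₜ mono s)) = _
    rw [LinearMap.lTensor_tmul, functional_mono, TensorProduct.rid_tmul]
  rw [eq_top_iff]
  intro w _
  have hw : (w : V) ∈ Submodule.span ℂ {x : V | ∃ v ∈ S, ∃ s, x = ⁅k B hB s, (v : V)⁆} := by
    rw [span_lie_k_eq_top hV hirr β S hS hST]; trivial
  have hle : Submodule.span ℂ {x : V | ∃ v ∈ S, ∃ s, x = ⁅k B hB s, (v : V)⁆} ≤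
      (S.comap π).map (evalMap hB V β) := by
    rw [Submodule.span_le]
    rintro _ ⟨v, hv, s, rfl⟩
    refine ⟨v ⊗ₜ mono s, ?_, evalMap_tmul_mono β v s⟩
    change π (v ⊗ₜ mono s) ∈ S
    rw [hπ]
    exact S.smul_mem _ hv
  obtain ⟨y, hy, hyw⟩ := hle hw
  have h1 : evalMap hB V β (w ⊗ₜ mono 0) = w := by rw [evalMap_tmul_mono, hV.2]
  have h2 : y = w ⊗ₜ mono 0 := evalMap_injective hV β (hyw.trans h1.symm)
  have h3 : π y ∈ S := hy
  rw [h2, hπ, if_pos rfl, one_smul] at h3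
  exact h3

/-- Any non-zero weight space serves as `V₀`. The jet action on `V₀ ⊗ A` is transported from `V`, so
only the formulas need checking. -/
theorem exists_tensor_model {V : Type u} [AddCommGroup V] [Module ℂ V]
    [LieRingModule (JetAlg B hB) V] [LieModule ℂ (JetAlg B hB) V] (hV : IsJetModule hB V)
    (hirr : LieModule.IsIrreducible ℂ (JetAlg B hB) V) (hfin : HasFiniteDimWeightSpaces hB V) :
    ∃ (V₀ : Type u) (_ : AddCommGroup V₀) (_ : Module ℂ V₀)
      (_ : LieRingModule (TAlg B hB) V₀) (_ : LieModule ℂ (TAlg B hB) V₀)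
      (_ : LieRingModule (JetAlg B hB) (V₀ ⊗[ℂ] Laurent N))
      (_ : LieModule ℂ (JetAlg B hB) (V₀ ⊗[ℂ] Laurent N)) (β : Fin N → ℂ),
      FiniteDimensional ℂ V₀ ∧ LieModule.IsIrreducible ℂ (TAlg B hB) V₀ ∧
      IsTensorAction hB V₀ β ∧ Nonempty (V ≃ₗ⁅ℂ, JetAlg B hB⁆ V₀ ⊗[ℂ] Laurent N) := by
  have : Nontrivial V := LieModule.nontrivial_of_isIrreducible ℂ (JetAlg B hB) V
  obtain ⟨β, hβ⟩ : ∃ β, weightSpace hB V β ≠ ⊥ := by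
    by_contra! hall
    have h1 := hfin.1
    simp only [hall, iSup_bot] at h1
    exact bot_ne_top h1
  let e : weightSpace hB V β ⊗[ℂ] Laurent N ≃ₗ[ℂ] V := LinearEquiv.ofBijective (evalMap hB V β)
    ⟨evalMap_injective hV β, evalMap_surjective hV hirr β hβ⟩
  have he : ∀ (v : weightSpace hB V β) s, e (v ⊗ₜ mono s) = ⁅k B hB s, (v : V)⁆ := fun v s => rfl
  let i1 : LieRingModule (TAlg B hB) (weightSpace hB V β) :=
    LieRingModule.compLieHom _ (weightRep hV β)
  have i2 : LieModule ℂ (TAlg B hB) (weightSpace hB V β) :=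
    LieModule.compLieHom _ (weightRep hV β)
  let i3 : LieRingModule (JetAlg B hB) (weightSpace hB V β ⊗[ℂ] Laurent N) :=
    { bracket := fun x y => e.symm ⁅x, e y⁆
      add_lie := fun x y v => by
        change e.symm ⁅x + y, e v⁆ = e.symm ⁅x, e v⁆ + e.symm ⁅y, e v⁆
        rw [add_lie, map_add]
      lie_add := fun x v w => by
        change e.symm ⁅x, e (v + w)⁆ = e.symm ⁅x, e v⁆ + e.symm ⁅x, e w⁆
        rw [map_add, lie_add, map_add]
      leibniz_lie := fun x y v => by
        change e.symm ⁅x, e (e.symm ⁅y, e v⁆)⁆ =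
          e.symm ⁅⁅x, y⁆, e v⁆ + e.symm ⁅y, e (e.symm ⁅x, e v⁆)⁆
        rw [LinearEquiv.apply_symm_apply, LinearEquiv.apply_symm_apply, leibniz_lie, map_add] }
  have hact : ∀ (x : JetAlg B hB) (y : weightSpace hB V β ⊗[ℂ] Laurent N),
      ⁅x, y⁆ = e.symm ⁅x, e y⁆ := fun _ _ => rfl
  have i4 : LieModule ℂ (JetAlg B hB) (weightSpace hB V β ⊗[ℂ] Laurent N) :=
    { smul_lie := fun c x v => by rw [hact, hact, smul_lie, map_smul]
      lie_smul := fun c x v => by rw [hact, hact, map_smul, lie_smul, map_smul] }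
  refine ⟨weightSpace hB V β, inferInstance, inferInstance, i1, i2, i3, i4, β, hfin.2 β, ?_, ?_,
    ⟨?_⟩⟩
  · have : Nontrivial (weightSpace hB V β) := Submodule.nontrivial_iff_ne_bot.mpr hβ
    refine LieModule.IsIrreducible.mk fun S hS => ?_
    rw [← LieSubmodule.toSubmodule_eq_top]
    refine eq_top_of_weightRep_stable hV hirr β S.toSubmodule
      (fun h0 => hS ((LieSubmodule.toSubmodule_eq_bot S).mp h0)) fun r v hv => ?_
    exact S.lie_mem (x := T B hB r) hv
  · intro v s
    refine ⟨fun r => ?_, fun u => ?_, fun r => ?_⟩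
    · rw [hact, LinearEquiv.symm_apply_eq, he, he, hV.1, add_comm]
    · rw [hact, LinearEquiv.symm_apply_eq, map_smul, he, lie_k_mem_weightSpace v.2 s u, add_comm β]
    · rw [hact, LinearEquiv.symm_apply_eq, map_add, map_smul, he, he, he, lie_h_lie_k hV]
      rfl
  · exact { e.symm with
      map_lie' := fun {x v} => by
        change e.symm ⁅x, v⁆ = e.symm ⁅x, e (e.symm v)⁆
        rw [LinearEquiv.apply_symm_apply] }

end

end JetModule

theorem theorem4p1 (m : ℕ) (B : Matrix (Fin (2 * m)) (Fin (2 * m)) ℂ) (hB : Bᵀ = -B)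
    (hnd : B.Nondegenerate) :
    (∀ (V : Type u) [AddCommGroup V] [Module ℂ V] [LieRingModule (JetModule.JetAlg B hB) V]
        [LieModule ℂ (JetModule.JetAlg B hB) V],
      JetModule.IsJetModule hB V →
      LieModule.IsIrreducible ℂ (JetModule.JetAlg B hB) V →
      JetModule.HasFiniteDimWeightSpaces hB V →
      ∃ (V₀ : Type u) (_ : AddCommGroup V₀) (_ : Module ℂ V₀)
        (_ : LieRingModule (JetModule.TAlg B hB) V₀) (_ : LieModule ℂ (JetModule.TAlg B hB) V₀)
        (_ : LieRingModule (JetModule.JetAlg B hB) (V₀ ⊗[ℂ] JetModule.Laurent (2 * m)))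
        (_ : LieModule ℂ (JetModule.JetAlg B hB) (V₀ ⊗[ℂ] JetModule.Laurent (2 * m)))
        (β : Fin (2 * m) → ℂ),
        FiniteDimensional ℂ V₀ ∧
        LieModule.IsIrreducible ℂ (JetModule.TAlg B hB) V₀ ∧
        JetModule.IsTensorAction hB V₀ β ∧
        Nonempty (V ≃ₗ⁅ℂ, JetModule.JetAlg B hB⁆ V₀ ⊗[ℂ] JetModule.Laurent (2 * m))) ∧
    ∃ (ψ : JetModule.TAlg B hB →ₗ⁅ℂ⁆ JetModule.GB B)
      (Φ : JetModule.GB B ≃ₗ⁅ℂ⁆ LieAlgebra.Symplectic.sp (Fin m) ℂ),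
      (∀ r : Fin (2 * m) → ℤ,
        (ψ (JetModule.T B hB r) : Matrix (Fin (2 * m)) (Fin (2 * m)) ℂ) =
          JetModule.rankOne B r) ∧
      Function.Surjective ψ ∧
      (∀ (V₀ : Type v) [AddCommGroup V₀] [Module ℂ V₀] [FiniteDimensional ℂ V₀]
          [LieRingModule (JetModule.TAlg B hB) V₀] [LieModule ℂ (JetModule.TAlg B hB) V₀],
        LieModule.IsIrreducible ℂ (JetModule.TAlg B hB) V₀ →
        ∃ (_ : LieRingModule (LieAlgebra.Symplectic.sp (Fin m) ℂ) V₀)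
          (_ : LieModule ℂ (LieAlgebra.Symplectic.sp (Fin m) ℂ) V₀)
          (χ : JetModule.TAlg B hB →ₗ⁅ℂ⁆ ℂ),
          LieModule.IsIrreducible ℂ (LieAlgebra.Symplectic.sp (Fin m) ℂ) V₀ ∧
          ∀ (x : JetModule.TAlg B hB) (v : V₀), ⁅x, v⁆ = ⁅Φ (ψ x), v⁆ + χ x • v) ∧
      (∀ (W : Type w) [AddCommGroup W] [Module ℂ W] [FiniteDimensional ℂ W]
          [LieRingModule (LieAlgebra.Symplectic.sp (Fin m) ℂ) W]
          [LieModule ℂ (LieAlgebra.Symplectic.sp (Fin m) ℂ) W],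
        LieModule.IsIrreducible ℂ (LieAlgebra.Symplectic.sp (Fin m) ℂ) W →
        ∀ χ : JetModule.TAlg B hB →ₗ⁅ℂ⁆ ℂ,
          ∃ (_ : LieRingModule (JetModule.TAlg B hB) W) (_ : LieModule ℂ (JetModule.TAlg B hB) W),
          LieModule.IsIrreducible ℂ (JetModule.TAlg B hB) W ∧
          ∀ (x : JetModule.TAlg B hB) (v : W), ⁅x, v⁆ = ⁅Φ (ψ x), v⁆ + χ x • v) := by
  obtain ⟨Φ⟩ := JetModule.nonempty_GB_equiv_sp m B hB hnd
  have hsurj := JetModule.psi_surjective hB hnd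
  refine ⟨fun V _ _ _ _ hV hirr hfin => JetModule.exists_tensor_model hV hirr hfin,
    JetModule.psi hB, Φ, JetModule.psi_T hB, hsurj, fun V₀ _ _ _ _ _ hV₀ =>
      JetModule.exists_symplectic_action hB hnd hV₀ (JetModule.psi hB) (JetModule.psi_T hB) hsurj Φ,
    fun W _ _ _ _ _ hW χ => ?_⟩
  exact LieModule.exists_twisted_pullback
    ((Φ : JetModule.GB B →ₗ⁅ℂ⁆ LieAlgebra.Symplectic.sp (Fin m) ℂ).comp (JetModule.psi hB))
    (Φ.surjective.comp hsurj) hW χ
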